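/- Let $(M,g)$ be a smooth Riemannian manifold of dimension $m$, with Levi-Civita connection $\nabla$. Let $\pi:TM\to M$ be the tangent bundle, $T(TM)=H\oplus V$ the splitting into the horizontal bundle of $\nabla$ and the vertical bundle $V=\ker d\pi$, and identify both $H$ and $V$ with $\pi^*TM$ in the canonical way ($H$ by $d\pi$, $V$ by the connection map of $\nabla$). For constants $f_1,f_2>0$ let $g^{f_1,f_2}=f_1\,\pi^*g\oplus f_2\,\pi^*g$ be the weighted Sasaki metric on $TM$. For a constant $r>0$ let $S_rM=\{u\in TM:\ \|u\|=r\}$, an embedded hypersurface of $TM$, with the metric induced by $g^{f_1,f_2}$ (also denoted $g^{f_1,f_2}$). Fix $r>0$. 1. If $m=2$, then for all constants $f_1,f_2>0$ the bundles $TM$ and $S_rM$ have the same Ricci and scalar curvatures: at each $u\in S_rM$, the Ricci tensor of $(S_rM,g^{f_1,f_2})$ is the restriction to $T_uS_rM$ of the Ricci tensor of $(TM,g^{f_1,f_2})$, and the scalar curvatures of $(S_rM,g^{f_1,f_2})$ and $(TM,g^{f_1,f_2})$ at $u$ are equal. 2. Suppose that $m\geq 3$ and that the sectional curvatures of $M$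 are bounded, i.e. there is a constant $C$ such that $|K(\Pi)|\leq C$ for all tangent planes $\Pi$ of $M$. Then: (a) for every constant $f_2>0$ there is $c>0$ such that for every constant $f_1\geq c$ the manifold $(S_rM,g^{f_1,f_2})$ has positive scalar curvature at every point; (b) for every constant $f_1>0$ there is $c>0$ such that for every constant $f_2$ with $0<f_2\leq c$ the manifold $(S_rM,g^{f_1,f_2})$ has positive scalar curvature at every point. -/

import Mathlib

open scoped Manifold ContDiff Bundle

set_option maxSynthPendingDepth 3

noncomputable section

namespace RiemCurv

/-! ## Riemannian metrics in coordinates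

`G : F → F →L[ℝ] F →L[ℝ] ℝ` is a field of inner products on (an open subset of) a
finite-dimensional space `F`. -/

section Coordinates

variable {F : Type*} [NormedAddCommGroup F] [NormedSpace ℝ F]

/-- The lowered Christoffel symbols (first kind):
`koszul G z v w y = ½ (∂_v G(w, y) + ∂_w G(v, y) - ∂_y G(v, w))` at the point `z`. -/
def koszul (G : F → F →L[ℝ] F →L[ℝ] ℝ) (z : F) : F →L[ℝ] F →L[ℝ] F →L[ℝ] ℝ :=
  (1 / 2 : ℝ) • (fderiv ℝ G z + (fderiv ℝ G z).flip -
    ((ContinuousLinearMap.flipₗᵢ ℝ F F ℝ).toContinuousLinearEquiv :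
      (F →L[ℝ] F →L[ℝ] ℝ) →L[ℝ] (F →L[ℝ] F →L[ℝ] ℝ)) ∘L (fderiv ℝ G z).flip)

theorem koszul_apply (G : F → F →L[ℝ] F →L[ℝ] ℝ) (z v w y : F) :
    koszul G z v w y =
      (1 / 2) * (fderiv ℝ G z v w y + fderiv ℝ G z w v y - fderiv ℝ G z y v w) := by
  simp [koszul]

/-- The Christoffel symbols of the Levi-Civita connection, so that
`∇_v w = ∂_v w + christoffel G z v w`: the index of `koszul` is raised with the inverse of
`G z`, seen as an isomorphism of `F` with its dual. -/
def christoffel (G : F → F →L[ℝ] F →L[ℝ] ℝ) (z : F) : F →L[ℝ] F →L[ℝ] F :=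
  (ContinuousLinearMap.compL ℝ F (F →L[ℝ] ℝ) F (G z).inverse) ∘L (koszul G z)

/-- The Riemann curvature tensor
`R(x, y) w = ∇_x ∇_y w - ∇_y ∇_x w - ∇_[x, y] w` in coordinates. -/
def curv (G : F → F →L[ℝ] F →L[ℝ] ℝ) (z x y w : F) : F :=
  fderiv ℝ (christoffel G) z x y w - fderiv ℝ (christoffel G) z y x w +
    christoffel G z x (christoffel G z y w) - christoffel G z y (christoffel G z x w)

/-- The linear map `x ↦ R(x, y) w`. -/
def curvLin (G : F → F →L[ℝ] F →L[ℝ] ℝ) (z y w : F) : F →ₗ[ℝ] F where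
  toFun x := curv G z x y w
  map_add' a b := by simp only [curv, map_add, add_apply]; abel
  map_smul' c a := by
    simp only [curv, map_smul, smul_apply, RingHom.id_apply, smul_sub, smul_add]

/-- The Ricci tensor `ric(y, w) = tr (x ↦ R(x, y) w)`. -/
def ric (G : F → F →L[ℝ] F →L[ℝ] ℝ) (z : F) : F →ₗ[ℝ] F →ₗ[ℝ] ℝ :=
  LinearMap.mk₂ ℝ (fun y w => LinearMap.trace ℝ F (curvLin G z y w))
    (fun y y' w => by
      rw [← map_add]; congr 1; ext x
      simp only [curvLin, curv, LinearMap.add_apply, LinearMap.coe_mk, AddHom.coe_mk, map_add,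
        add_apply]
      abel)
    (fun c y w => by
      rw [← map_smul]; congr 1; ext x
      simp only [curvLin, curv, LinearMap.smul_apply, LinearMap.coe_mk, AddHom.coe_mk, map_smul,
        smul_apply, smul_sub, smul_add])
    (fun y w w' => by
      rw [← map_add]; congr 1; ext x
      simp only [curvLin, curv, LinearMap.add_apply, LinearMap.coe_mk, AddHom.coe_mk, map_add]
      abel)
    (fun c y w => by
      rw [← map_smul]; congr 1; ext x
      simp only [curvLin, curv, LinearMap.smul_apply, LinearMap.coe_mk, AddHom.coe_mk, map_smul,
        smul_sub, smul_add])

/-- The Ricci endomorphism, `G (Ric y, w) = ric (y, w)`. -/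
def ricEnd [FiniteDimensional ℝ F] (G : F → F →L[ℝ] F →L[ℝ] ℝ) (z : F) : F →ₗ[ℝ] F :=
  ((G z).inverse : (F →L[ℝ] ℝ) →ₗ[ℝ] F) ∘ₗ
    (LinearMap.toContinuousLinearMap (𝕜 := ℝ) (E := F) (F' := ℝ)).toLinearMap ∘ₗ ric G z

/-- The scalar curvature, the trace of the Ricci endomorphism. -/
def scal [FiniteDimensional ℝ F] (G : F → F →L[ℝ] F →L[ℝ] ℝ) (z : F) : ℝ :=
  LinearMap.trace ℝ F (ricEnd G z)

end Coordinates

/-! ## Riemannian metrics on manifolds without boundary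

The tangent space of `N` at `p` is, in Mathlib, the model vector space `F`, a tangent vector being
identified with its coordinates in the preferred chart at `p`. All tensors at `p` are therefore
computed in this chart. -/

section Manifolds

variable {F : Type*} [NormedAddCommGroup F] [NormedSpace ℝ F]
  {H : Type*} [TopologicalSpace H] (I : ModelWithCorners ℝ F H)
  {N : Type*} [TopologicalSpace N] [ChartedSpace H N]

/-- The pull-back of a metric `h` on `N` by a map `ψ` from a vector space to `N`:
`(v, w) ↦ h (dψ v, dψ w)`. -/
def pullbackMetric {F' : Type*} [NormedAddCommGroup F'] [NormedSpace ℝ F']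
    (h : ∀ p : N, TangentSpace I p →L[ℝ] TangentSpace I p →L[ℝ] ℝ) (ψ : F' → N) (z : F') :
    F' →L[ℝ] F' →L[ℝ] ℝ :=
  ContinuousLinearMap.bilinearComp (E' := F') (F' := F') (E := F) (F := F) (h (ψ z))
    (mfderiv 𝓘(ℝ, F') I ψ z) (mfderiv 𝓘(ℝ, F') I ψ z)

/-- The metric `h` read in the preferred chart at `p`. -/
def chartMetric (h : ∀ p : N, TangentSpace I p →L[ℝ] TangentSpace I p →L[ℝ] ℝ) (p : N) :
    F → F →L[ℝ] F →L[ℝ] ℝ :=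
  pullbackMetric I h (extChartAt I p).symm

/-- Christoffel symbols at `p`, in the preferred chart at `p`. -/
def christoffelAt (h : ∀ p : N, TangentSpace I p →L[ℝ] TangentSpace I p →L[ℝ] ℝ) (p : N) :
    TangentSpace I p →L[ℝ] TangentSpace I p →L[ℝ] TangentSpace I p :=
  christoffel (F := F) (chartMetric I h p) (extChartAt I p p)

/-- The Riemann curvature tensor `R(v, w) y` of `(N, h)` at `p`. -/
def curvAt (h : ∀ p : N, TangentSpace I p →L[ℝ] TangentSpace I p →L[ℝ] ℝ) (p : N)
    (v w y : TangentSpace I p) : TangentSpace I p :=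
  curv (F := F) (chartMetric I h p) (extChartAt I p p) v w y

/-- The Ricci tensor of `(N, h)` at `p`. -/
def ricAt (h : ∀ p : N, TangentSpace I p →L[ℝ] TangentSpace I p →L[ℝ] ℝ) (p : N) :
    TangentSpace I p →ₗ[ℝ] TangentSpace I p →ₗ[ℝ] ℝ :=
  ric (F := F) (chartMetric I h p) (extChartAt I p p)

/-- The scalar curvature of `(N, h)` at `p`. -/
def scalAt [FiniteDimensional ℝ F]
    (h : ∀ p : N, TangentSpace I p →L[ℝ] TangentSpace I p →L[ℝ] ℝ) (p : N) : ℝ :=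
  scal (F := F) (chartMetric I h p) (extChartAt I p p)

/-- The sectional curvature of the plane spanned by `v` and `w`. -/
def sectionalAt (h : ∀ p : N, TangentSpace I p →L[ℝ] TangentSpace I p →L[ℝ] ℝ) (p : N)
    (v w : TangentSpace I p) : ℝ :=
  h p (curvAt I h p v w w) v / (h p v v * h p w w - h p v w ^ 2)

/-- `(N, h)` has bounded sectional curvature. -/
def BoundedSectionalCurvature
    (h : ∀ p : N, TangentSpace I p →L[ℝ] TangentSpace I p →L[ℝ] ℝ) : Prop :=
  ∃ C : ℝ, ∀ (p : N) (v w : TangentSpace I p), LinearIndependent ℝ ![v, w] →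
    |sectionalAt I h p v w| ≤ C

/-! ### Embedded submanifolds and their induced metrics -/

/-- `ψ`, restricted to the open set `V` of `ℝᵈ`, is a local parametrization of the subset `S` of
`N`: a smooth immersion which is a homeomorphism of `V` onto a relatively open subset of `S`. -/
structure IsLocalParam {d : ℕ} (S : Set N) (V : Set (EuclideanSpace ℝ (Fin d)))
    (ψ : EuclideanSpace ℝ (Fin d) → N) : Prop where
  isOpen : IsOpen V
  contMDiffOn : ContMDiffOn 𝓘(ℝ, EuclideanSpace ℝ (Fin d)) I ∞ ψ V
  injective_mfderiv : ∀ z ∈ V,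
    Function.Injective (mfderiv 𝓘(ℝ, EuclideanSpace ℝ (Fin d)) I ψ z)
  isEmbedding : Topology.IsEmbedding (V.domRestrict ψ)
  image_eq : ∃ O : Set N, IsOpen O ∧ ψ '' V = S ∩ O

/-- `S` is a smooth embedded submanifold of `N`, of dimension `d`. -/
def IsSubmanifold (d : ℕ) (S : Set N) : Prop :=
  ∀ p ∈ S, ∃ (V : Set (EuclideanSpace ℝ (Fin d))) (ψ : EuclideanSpace ℝ (Fin d) → N),
    IsLocalParam I S V ψ ∧ p ∈ ψ '' V

/-- The `d`-dimensional submanifold `S` of `(N, h)`, with the induced metric, has the same Ricci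
curvature and the same scalar curvature as `(N, h)`: its Ricci tensor is the restriction to the
tangent spaces of `S` of the Ricci tensor of `N`, its scalar curvature is the restriction to `S`
of the scalar curvature of `N`. The left-hand sides are computed in an arbitrary local
parametrization of `S`. -/
def SameRicciAndScalarCurvature [FiniteDimensional ℝ F] (d : ℕ)
    (h : ∀ p : N, TangentSpace I p →L[ℝ] TangentSpace I p →L[ℝ] ℝ) (S : Set N) : Prop :=
  IsSubmanifold I d S ∧
  ∀ (V : Set (EuclideanSpace ℝ (Fin d))) (ψ : EuclideanSpace ℝ (Fin d) → N),
    IsLocalParam I S V ψ → ∀ z ∈ V,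
      (∀ v w : EuclideanSpace ℝ (Fin d),
        ric (pullbackMetric I h ψ) z v w =
          ricAt I h (ψ z) (mfderiv 𝓘(ℝ, EuclideanSpace ℝ (Fin d)) I ψ z v)
            (mfderiv 𝓘(ℝ, EuclideanSpace ℝ (Fin d)) I ψ z w)) ∧
      scal (pullbackMetric I h ψ) z = scalAt I h (ψ z)

/-- The `d`-dimensional submanifold `S` of `(N, h)`, with the induced metric, has positive scalar
curvature at each of its points. -/
def HasPositiveScalarCurvature (d : ℕ)
    (h : ∀ p : N, TangentSpace I p →L[ℝ] TangentSpace I p →L[ℝ] ℝ) (S : Set N) : Prop :=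
  IsSubmanifold I d S ∧
  ∀ (V : Set (EuclideanSpace ℝ (Fin d))) (ψ : EuclideanSpace ℝ (Fin d) → N),
    IsLocalParam I S V ψ → ∀ z ∈ V, 0 < scal (pullbackMetric I h ψ) z

end Manifolds

/-! ## The tangent bundle and the tangent sphere bundles -/

section TangentBundle

variable {E : Type*} [NormedAddCommGroup E] [NormedSpace ℝ E]
  {M : Type*} [TopologicalSpace M] [ChartedSpace E M] [IsManifold 𝓘(ℝ, E) ∞ M]

/-- The differential `dπ : T_u(TM) → T_{π u}M` of the projection of the tangent bundle. Its kernel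
is the vertical space. -/
def dproj (u : TangentBundle 𝓘(ℝ, E) M) :
    TangentSpace 𝓘(ℝ, E).tangent u →L[ℝ] TangentSpace 𝓘(ℝ, E) u.proj :=
  mfderiv 𝓘(ℝ, E).tangent 𝓘(ℝ, E) (Bundle.TotalSpace.proj : TangentBundle 𝓘(ℝ, E) M → M) u

/-- The connection map `K : T_u(TM) → T_{π u}M` of the Levi-Civita connection of `h`. A vector
`(a, b) ∈ T_u(TM) = E × E` (in the coordinates of `TM` induced by the preferred chart of `M` at
`π u`) is sent to `b + Γ(a, u)`. Thus `K (X' (0))` is the covariant derivative at `0` of the vector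
field `X` along the curve `π ∘ X`, for every curve `X` in `TM`; the kernel of `K` is the
horizontal space `H`, and on vertical vectors `K` is the canonical identification of the vertical
space with `T_{π u}M`. -/
def connectionMap (h : ∀ p : M, TangentSpace 𝓘(ℝ, E) p →L[ℝ] TangentSpace 𝓘(ℝ, E) p →L[ℝ] ℝ)
    (u : TangentBundle 𝓘(ℝ, E) M) :
    TangentSpace 𝓘(ℝ, E).tangent u →L[ℝ] TangentSpace 𝓘(ℝ, E) u.proj :=
  ContinuousLinearMap.snd ℝ E E +
    (ContinuousLinearMap.flip (E := E) (F := E) (G := E)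
      (christoffelAt 𝓘(ℝ, E) h u.proj) u.snd) ∘L ContinuousLinearMap.fst ℝ E E

/-- The weighted Sasaki metric `f₁ π^*h ⊕ f₂ π^*h` on `T(TM) = H ⊕ V`, with constant weights. -/
def sasakiMetric (h : ∀ p : M, TangentSpace 𝓘(ℝ, E) p →L[ℝ] TangentSpace 𝓘(ℝ, E) p →L[ℝ] ℝ)
    (f₁ f₂ : ℝ) (u : TangentBundle 𝓘(ℝ, E) M) :
    TangentSpace 𝓘(ℝ, E).tangent u →L[ℝ] TangentSpace 𝓘(ℝ, E).tangent u →L[ℝ] ℝ :=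
  f₁ • ContinuousLinearMap.bilinearComp (E := E) (F := E) (E' := E × E) (F' := E × E)
      (h u.proj) (dproj u) (dproj u) +
    f₂ • ContinuousLinearMap.bilinearComp (E := E) (F := E) (E' := E × E) (F' := E × E)
      (h u.proj) (connectionMap h u) (connectionMap h u)

/-- The tangent sphere bundle `S_r M = {u ∈ TM : ‖u‖ = r}`, for `r > 0`. -/
def sphereBundle (h : ∀ p : M, TangentSpace 𝓘(ℝ, E) p →L[ℝ] TangentSpace 𝓘(ℝ, E) p →L[ℝ] ℝ)
    (r : ℝ) : Set (TangentBundle 𝓘(ℝ, E) M) :=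
  {u | h u.proj u.snd u.snd = r ^ 2}

end TangentBundle

end RiemCurv

end

/-!
Let `N` be the Liouville field on `TM`, the vertical field whose value at `u` is `u` itself. It is
normal to the sphere bundle `S_r M`, of square length `f₂ r²`, and two facts about it carry the
proof. First, `∇_X N` is the vertical part of `X` (`christoffel_liouville`), so that the second
fundamental form of `S_r M` is, up to normalization, the vertical part of the metric
(`covHess_liouville`): all of its nonzero principal curvatures are equal, and there are `m - 1` of
them. Second, the curvature operator `R(·, N) N` vanishes (`curv_coordSasaki_liouville`), so that
the passage from `TM` to `S_r M` loses nothing in the traces of the curvature tensor. The Gauss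
equation (`IsImmersionOn.apply_curv_pull`) then gives (`ric_scal_hypersurface`)

* `ric_S = ric_TM + (m - 2) / (f₂ r²) * (vertical part of the metric)`,
* `scal_S = scal_TM + (m - 1) (m - 2) / (f₂ r²)`.

For `m = 2` the correction terms vanish. For `m ≥ 3` the second one is positive, and it is compared
with a lower bound for `scal_TM`. For the Sasaki metric vertical planes are flat, mixed planes have
nonnegative curvature, and O'Neill's formula
`R(a, b, b, a) = f₁ R^M(a, b, b, a) - ¾ f₂ |R^M(a, b) u|²` holds on horizontal lifts
(`curv_coordSasaki_horizontal`). If the sectional curvatures of `M` are bounded, so is its curvature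
tensor (`sq_curv_le`), and `scal_TM` is bounded below by `-(A / f₁ + B f₂ / f₁²)` on `S_r M`, with
`A` and `B` independent of the weights (`scal_coordSasaki_ge`). Either choice of the weights makes
the positive term dominate.

The curvature of the Sasaki metric is computed in coordinates, at a point where the Christoffel
symbols vanish: there a second order change of coordinates is enough (`normalMap`), and its tangent
map is an isometry of the Sasaki metrics (`pull_coordSasaki_tmap`). The same fact, applied to
changes of charts, identifies the Sasaki metric of `M` read in a chart of `TM` with the coordinate
expression (`chartMetric_sasakiMetric`). That `S_r M` is a hypersurface is seen from the radial
projection of an affine tangent hyperplane onto the sphere (`exists_sphere_param`).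
-/

open scoped Topology

noncomputable section

namespace RiemCurv

open Set Filter

/-! ### Derivatives along lines -/

section Lines

variable {F X : Type*} [NormedAddCommGroup F] [NormedSpace ℝ F] [NormedAddCommGroup X]
  [NormedSpace ℝ X]

theorem two_le_infty : (2 : ℕ∞ω) ≤ ∞ :=
  WithTop.coe_le_coe.2 (le_top : (2 : ℕ∞) ≤ ⊤)

theorem hasDerivAt_line {f : F → X} {z : F} (hf : DifferentiableAt ℝ f z) (v : F) :
    HasDerivAt (fun t : ℝ => f (z + t • v)) (fderiv ℝ f z v) 0 := by
  have hl : HasDerivAt (fun t : ℝ => z + t • v) v 0 := by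
    simpa using ((hasDerivAt_id (0 : ℝ)).smul_const v).const_add z
  have hf' : HasFDerivAt f (fderiv ℝ f z) (z + (0 : ℝ) • v) := by
    simpa using hf.hasFDerivAt
  exact hf'.comp_hasDerivAt (0 : ℝ) hl

theorem hasDerivAt_add_smul (z v : F) : HasDerivAt (fun t : ℝ => z + t • v) v 0 := by
  simpa using ((hasDerivAt_id (0 : ℝ)).smul_const v).const_add z

theorem tendsto_line (z v : F) : Tendsto (fun t : ℝ => z + t • v) (𝓝 0) (𝓝 z) := by
  have h := (hasDerivAt_add_smul z v).continuousAt
  simpa [ContinuousAt] using h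

/-- The derivative at `z` in the direction `v`, from the derivative along a line of a function
which agrees with `f` near `z`. -/
theorem fderiv_eq_of_line {f g : F → X} {z v : F} {d : X} (hf : DifferentiableAt ℝ f z)
    (hg : f =ᶠ[𝓝 z] g) (hd : HasDerivAt (fun t : ℝ => g (z + t • v)) d 0) :
    fderiv ℝ f z v = d := by
  refine (hasDerivAt_line hf v).unique (hd.congr_of_eventuallyEq ?_)
  exact (tendsto_line z v).eventually hg

end Lines

/-! ### Smooth metrics on an open set -/

section Basics

variable {F : Type*} [NormedAddCommGroup F] [NormedSpace ℝ F]
  {F' : Type*} [NormedAddCommGroup F'] [NormedSpace ℝ F']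

/-- `G` is a smooth Riemannian metric on the open subset `U` of the vector space `F`. -/
structure IsMetricOn (G : F → F →L[ℝ] F →L[ℝ] ℝ) (U : Set F) : Prop where
  isOpen : IsOpen U
  contDiffOn : ContDiffOn ℝ ∞ G U
  symm : ∀ z ∈ U, ∀ v w, G z v w = G z w v
  pos : ∀ z ∈ U, ∀ v, v ≠ 0 → 0 < G z v v

namespace IsMetricOn

variable {G : F → F →L[ℝ] F →L[ℝ] ℝ} {U : Set F} {z : F}

theorem nonneg (hG : IsMetricOn G U) (hz : z ∈ U) (v : F) : 0 ≤ G z v v := by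
  rcases eq_or_ne v 0 with rfl | hv
  · simp
  · exact (hG.pos z hz v hv).le

theorem mem_nhds (hG : IsMetricOn G U) (hz : z ∈ U) : U ∈ 𝓝 z := hG.isOpen.mem_nhds hz

theorem eq_of_forall (hG : IsMetricOn G U) (hz : z ∈ U) {a b : F}
    (h : ∀ y, G z a y = G z b y) : a = b := by
  by_contra hab
  have h1 := hG.pos z hz (a - b) (sub_ne_zero.2 hab)
  have h2 := h (a - b)
  simp only [map_sub, sub_apply] at h1 h2
  linarith

theorem isInvertible [FiniteDimensional ℝ F] (hG : IsMetricOn G U) (hz : z ∈ U) :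
    (G z).IsInvertible := by
  have hinj : Function.Injective (G z) := fun a b hab =>
    hG.eq_of_forall hz fun y => by rw [hab]
  have hfin : Module.finrank ℝ F = Module.finrank ℝ (F →L[ℝ] ℝ) := by
    rw [← (LinearMap.toContinuousLinearMap (𝕜 := ℝ) (E := F) (F' := ℝ)).finrank_eq]
    exact (Subspace.dual_finrank_eq (K := ℝ) (V := F)).symm
  let e := LinearEquiv.ofInjectiveOfFinrankEq (G z : F →ₗ[ℝ] (F →L[ℝ] ℝ)) hinj hfin
  exact ⟨e.toContinuousLinearEquiv, by ext; rfl⟩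

theorem apply_inverse [FiniteDimensional ℝ F] (hG : IsMetricOn G U) (hz : z ∈ U) (l : F →L[ℝ] ℝ) :
    G z ((G z).inverse l) = l :=
  (hG.isInvertible hz).self_apply_inverse l

theorem differentiableAt (hG : IsMetricOn G U) (hz : z ∈ U) : DifferentiableAt ℝ G z :=
  (hG.contDiffOn.contDiffAt (hG.mem_nhds hz)).differentiableAt (by simp)

theorem contDiffOn_fderiv (hG : IsMetricOn G U) : ContDiffOn ℝ ∞ (fderiv ℝ G) U :=
  hG.contDiffOn.fderiv_of_isOpen hG.isOpen (by simp)

theorem contDiffOn_koszul (hG : IsMetricOn G U) : ContDiffOn ℝ ∞ (koszul G) U := by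
  have h := hG.contDiffOn_fderiv
  unfold koszul
  have hflip : ContDiffOn ℝ ∞ (fun z => (fderiv ℝ G z).flip) U :=
    (ContinuousLinearMap.flipₗᵢ ℝ F F (F →L[ℝ] ℝ)).contDiff.comp_contDiffOn h
  exact (((h.add hflip).sub (contDiffOn_const.clm_comp hflip)).const_smul (1 / 2 : ℝ))

theorem contDiffOn_christoffel [FiniteDimensional ℝ F] (hG : IsMetricOn G U) :
    ContDiffOn ℝ ∞ (christoffel G) U := by
  have : CompleteSpace F := FiniteDimensional.complete ℝ F
  unfold christoffel
  have hinv : ContDiffOn ℝ ∞ (fun z => (G z).inverse) U := fun z hz =>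
    ((hG.isInvertible hz).contDiffAt_map_inverse.comp_contDiffWithinAt z (hG.contDiffOn z hz))
  exact ((ContinuousLinearMap.compL ℝ F (F →L[ℝ] ℝ) F).contDiff.comp_contDiffOn hinv).clm_comp
    hG.contDiffOn_koszul

theorem differentiableAt_of_contDiffOn {X : Type*} [NormedAddCommGroup X] [NormedSpace ℝ X]
    {f : F → X} (hG : IsMetricOn G U) (hf : ContDiffOn ℝ ∞ f U) (hz : z ∈ U) :
    DifferentiableAt ℝ f z :=
  (hf.contDiffAt (hG.mem_nhds hz)).differentiableAt (by simp)

theorem apply_christoffel [FiniteDimensional ℝ F] (hG : IsMetricOn G U) (hz : z ∈ U) (v w y : F) :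
    G z (christoffel G z v w) y = koszul G z v w y := by
  have := hG.apply_inverse hz (koszul G z v w)
  simp only [christoffel, ContinuousLinearMap.comp_apply, ContinuousLinearMap.compL_apply]
  rw [this]

theorem fderiv_symm (hG : IsMetricOn G U) (hz : z ∈ U) (x v w : F) :
    fderiv ℝ G z x v w = fderiv ℝ G z x w v := by
  have h1 := ((hasDerivAt_line (hG.differentiableAt hz) x).clm_apply
    (hasDerivAt_const 0 v)).clm_apply (hasDerivAt_const 0 w)
  have h2 := ((hasDerivAt_line (hG.differentiableAt hz) x).clm_apply
    (hasDerivAt_const 0 w)).clm_apply (hasDerivAt_const 0 v)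
  have h3 : (fun t : ℝ => G (z + t • x) v w) =ᶠ[𝓝 0] fun t => G (z + t • x) w v := by
    filter_upwards [(tendsto_line z x).eventually (hG.mem_nhds hz)] with t ht
    exact hG.symm _ ht v w
  simpa using h1.unique (h2.congr_of_eventuallyEq h3)

theorem koszul_symm (hG : IsMetricOn G U) (hz : z ∈ U) (v w y : F) :
    koszul G z v w y = koszul G z w v y := by
  rw [koszul_apply, koszul_apply, hG.fderiv_symm hz y v w]; ring

theorem christoffel_symm (hG : IsMetricOn G U) (z : F) (hz : z ∈ U) (v w : F) :
    christoffel G z v w = christoffel G z w v := by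
  have h : koszul G z v w = koszul G z w v := by
    ext y; exact hG.koszul_symm hz v w y
  simp [christoffel, h]

/-- The Levi-Civita connection is metric. -/
theorem fderiv_eq_koszul (hG : IsMetricOn G U) (hz : z ∈ U) (x v w : F) :
    fderiv ℝ G z x v w = koszul G z x v w + koszul G z x w v := by
  rw [koszul_apply, koszul_apply, hG.fderiv_symm hz x w v, hG.fderiv_symm hz v x w,
    hG.fderiv_symm hz w x v]
  ring

theorem fderiv_eq_christoffel [FiniteDimensional ℝ F] (hG : IsMetricOn G U) (hz : z ∈ U)
    (x v w : F) :
    fderiv ℝ G z x v w = G z (christoffel G z x v) w + G z v (christoffel G z x w) := by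
  rw [hG.fderiv_eq_koszul hz, hG.apply_christoffel hz, hG.symm z hz v, hG.apply_christoffel hz]

theorem snd_fderiv_symm (hG : IsMetricOn G U) (hz : z ∈ U) (x y v w : F) :
    fderiv ℝ (fderiv ℝ G) z x y v w = fderiv ℝ (fderiv ℝ G) z y x v w := by
  have h : IsSymmSndFDerivAt ℝ G z :=
    (hG.contDiffOn.contDiffAt (hG.mem_nhds hz)).isSymmSndFDerivAt
      (by simpa using two_le_infty)
  rw [h.eq x y]

/-- The derivative of `G v w` is symmetric in `v` and `w`, to second order. -/
theorem snd_fderiv_symm' (hG : IsMetricOn G U) (hz : z ∈ U) (x y v w : F) :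
    fderiv ℝ (fderiv ℝ G) z x y v w = fderiv ℝ (fderiv ℝ G) z x y w v := by
  have hd := hG.differentiableAt_of_contDiffOn hG.contDiffOn_fderiv hz
  have h1 := (((hasDerivAt_line hd x).clm_apply (hasDerivAt_const 0 y)).clm_apply
    (hasDerivAt_const 0 v)).clm_apply (hasDerivAt_const 0 w)
  have h2 := (((hasDerivAt_line hd x).clm_apply (hasDerivAt_const 0 y)).clm_apply
    (hasDerivAt_const 0 w)).clm_apply (hasDerivAt_const 0 v)
  have h3 : (fun t : ℝ => fderiv ℝ G (z + t • x) y v w) =ᶠ[𝓝 0]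
      fun t => fderiv ℝ G (z + t • x) y w v := by
    filter_upwards [(tendsto_line z x).eventually (hG.mem_nhds hz)] with t ht
    exact hG.fderiv_symm ht y v w
  simpa using h1.unique (h2.congr_of_eventuallyEq h3)

theorem fderiv_koszul (hG : IsMetricOn G U) (hz : z ∈ U) (x v w y : F) :
    fderiv ℝ (koszul G) z x v w y =
      (1 / 2) * (fderiv ℝ (fderiv ℝ G) z x v w y + fderiv ℝ (fderiv ℝ G) z x w v y
        - fderiv ℝ (fderiv ℝ G) z x y v w) := by
  have hd := hG.differentiableAt_of_contDiffOn hG.contDiffOn_fderiv hz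
  have hk := hG.differentiableAt_of_contDiffOn hG.contDiffOn_koszul hz
  have h1 := (((hasDerivAt_line hk x).clm_apply (hasDerivAt_const 0 v)).clm_apply
    (hasDerivAt_const 0 w)).clm_apply (hasDerivAt_const 0 y)
  have h2 := fun a b c : F => (((hasDerivAt_line hd x).clm_apply
    (hasDerivAt_const 0 a)).clm_apply (hasDerivAt_const 0 b)).clm_apply (hasDerivAt_const 0 c)
  have h3 := (((h2 v w y).add (h2 w v y)).sub (h2 y v w)).const_mul (1 / 2 : ℝ)
  have h4 := h1.unique (h3.congr_of_eventuallyEq (Eventually.of_forall fun t => by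
    simp [koszul_apply]))
  simpa using h4

/-- The curvature tensor with lowered index, in terms of first derivatives of `koszul`. -/
theorem apply_curv [FiniteDimensional ℝ F] (hG : IsMetricOn G U) (hz : z ∈ U) (x y w v : F) :
    G z (curv G z x y w) v = fderiv ℝ (koszul G) z x y w v - fderiv ℝ (koszul G) z y x w v
      - G z (christoffel G z x v) (christoffel G z y w)
      + G z (christoffel G z y v) (christoffel G z x w) := by
  have hk := hG.differentiableAt_of_contDiffOn hG.contDiffOn_koszul hz
  have hc := hG.differentiableAt_of_contDiffOn hG.contDiffOn_christoffel hz
  have key : ∀ a b c : F, fderiv ℝ (koszul G) z a b c v =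
      fderiv ℝ G z a (christoffel G z b c) v + G z (fderiv ℝ (christoffel G) z a b c) v := by
    intro a b c
    have h1 := (((hasDerivAt_line hk a).clm_apply (hasDerivAt_const 0 b)).clm_apply
      (hasDerivAt_const 0 c)).clm_apply (hasDerivAt_const 0 v)
    have h2 := ((hasDerivAt_line (hG.differentiableAt hz) a).clm_apply
      (((hasDerivAt_line hc a).clm_apply (hasDerivAt_const 0 b)).clm_apply
      (hasDerivAt_const 0 c))).clm_apply (hasDerivAt_const 0 v)
    have h3 := h1.unique (h2.congr_of_eventuallyEq (by
      filter_upwards [(tendsto_line z a).eventually (hG.mem_nhds hz)] with t ht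
      exact (hG.apply_christoffel ht b c v).symm))
    simpa using h3
  rw [key, key, hG.fderiv_eq_christoffel hz, hG.fderiv_eq_christoffel hz]
  simp only [curv, map_add, map_sub, add_apply, sub_apply]
  rw [hG.symm z hz (christoffel G z y w) (christoffel G z x v),
    hG.symm z hz (christoffel G z x w) (christoffel G z y v)]
  ring

theorem curv_antisymm (G : F → F →L[ℝ] F →L[ℝ] ℝ) (z x y w : F) :
    curv G z x y w = -curv G z y x w := by
  simp only [curv]; abel

variable [FiniteDimensional ℝ F]

theorem apply_curv_pair_symm (hG : IsMetricOn G U) (hz : z ∈ U) (x y w v : F) :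
    G z (curv G z x y w) v = G z (curv G z w v x) y := by
  rw [hG.apply_curv hz, hG.apply_curv hz]
  simp only [hG.fderiv_koszul hz]
  rw [hG.christoffel_symm z hz w y, hG.christoffel_symm z hz v x,
    hG.christoffel_symm z hz v y, hG.christoffel_symm z hz w x,
    hG.symm z hz (christoffel G z y w)]
  have h := hG.snd_fderiv_symm hz
  have h' := hG.snd_fderiv_symm' hz
  linarith [h x y w v, h w v x y, h x w y v, h' w x y v, h x v y w, h' v x y w, h y w x v,
    h' w y x v, h y v x w, h' v y x w]

theorem apply_curv_antisymm (hG : IsMetricOn G U) (hz : z ∈ U) (x y w v : F) :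
    G z (curv G z x y w) v = -G z (curv G z x y v) w := by
  rw [hG.apply_curv_pair_symm hz x y w v, hG.apply_curv_pair_symm hz x y v w,
    curv_antisymm G z w v x]
  simp

theorem bianchi (hG : IsMetricOn G U) (hz : z ∈ U) (x y w v : F) :
    G z (curv G z x y w) v + G z (curv G z y w x) v + G z (curv G z w x y) v = 0 := by
  simp only [hG.apply_curv hz, hG.fderiv_koszul hz]
  rw [hG.snd_fderiv_symm hz x y, hG.snd_fderiv_symm hz x w, hG.snd_fderiv_symm hz w y,
    hG.snd_fderiv_symm' hz x v, hG.snd_fderiv_symm' hz y v, hG.snd_fderiv_symm' hz w v,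
    hG.christoffel_symm z hz x w, hG.christoffel_symm z hz y w,
    hG.christoffel_symm z hz x y]
  ring

end IsMetricOn

end Basics

/-! ### The Gauss equation -/

section Gauss

variable {F : Type*} [NormedAddCommGroup F] [NormedSpace ℝ F]
  {F' : Type*} [NormedAddCommGroup F'] [NormedSpace ℝ F']
  {X : Type*} [NormedAddCommGroup X] [NormedSpace ℝ X]

theorem hasDerivAt_comp_line {φ : F' → F} {f : F → X} {z : F'} (hf : DifferentiableAt ℝ f (φ z))
    (hφ : DifferentiableAt ℝ φ z) (v : F') :
    HasDerivAt (fun t : ℝ => f (φ (z + t • v))) (fderiv ℝ f (φ z) (fderiv ℝ φ z v)) 0 := by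
  have h := hasDerivAt_line (f := f ∘ φ) (hf.comp z hφ) v
  rwa [fderiv_comp z hf hφ] at h

/-- The pull-back of the metric `G` by a map `φ` between vector spaces. -/
def pull (G : F → F →L[ℝ] F →L[ℝ] ℝ) (φ : F' → F) (z : F') : F' →L[ℝ] F' →L[ℝ] ℝ :=
  (G (φ z)).bilinearComp (fderiv ℝ φ z) (fderiv ℝ φ z)

@[simp] theorem pull_apply (G : F → F →L[ℝ] F →L[ℝ] ℝ) (φ : F' → F) (z v w : F') :
    pull G φ z v w = G (φ z) (fderiv ℝ φ z v) (fderiv ℝ φ z w) := rfl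

/-- `φ` restricts to a smooth immersion of the open set `V` into `U`. -/
structure IsImmersionOn (φ : F' → F) (V : Set F') (U : Set F) : Prop where
  isOpen : IsOpen V
  contDiffOn : ContDiffOn ℝ ∞ φ V
  mapsTo : MapsTo φ V U
  injective : ∀ z ∈ V, Function.Injective (fderiv ℝ φ z)

/-- The covariant Hessian `∇dφ` of `φ`, computed with the flat connection on the source and the
Levi-Civita connection of `G` on the target. -/
def covHess (G : F → F →L[ℝ] F →L[ℝ] ℝ) (φ : F' → F) (z v w : F') : F :=
  fderiv ℝ (fderiv ℝ φ) z v w + christoffel G (φ z) (fderiv ℝ φ z v) (fderiv ℝ φ z w)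

namespace IsImmersionOn

variable {G : F → F →L[ℝ] F →L[ℝ] ℝ} {U : Set F} {φ : F' → F} {V : Set F'} {z : F'}

theorem mem_nhds (hφ : IsImmersionOn φ V U) (hz : z ∈ V) : V ∈ 𝓝 z := hφ.isOpen.mem_nhds hz

theorem contDiffOn_fderiv (hφ : IsImmersionOn φ V U) : ContDiffOn ℝ ∞ (fderiv ℝ φ) V :=
  hφ.contDiffOn.fderiv_of_isOpen hφ.isOpen (by simp)

theorem contDiffOn_snd_fderiv (hφ : IsImmersionOn φ V U) :
    ContDiffOn ℝ ∞ (fderiv ℝ (fderiv ℝ φ)) V :=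
  hφ.contDiffOn_fderiv.fderiv_of_isOpen hφ.isOpen (by simp)

theorem differentiableAt_of_contDiffOn (hφ : IsImmersionOn φ V U) {f : F' → X}
    (hf : ContDiffOn ℝ ∞ f V) (hz : z ∈ V) : DifferentiableAt ℝ f z :=
  (hf.contDiffAt (hφ.mem_nhds hz)).differentiableAt (by simp)

theorem isMetricOn_pull (hφ : IsImmersionOn φ V U) (hG : IsMetricOn G U) :
    IsMetricOn (pull G φ) V where
  isOpen := hφ.isOpen
  contDiffOn := by
    have h1 : ContDiffOn ℝ ∞ (fun z => G (φ z)) V := hG.contDiffOn.comp hφ.contDiffOn hφ.mapsTo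
    have h2 := hφ.contDiffOn_fderiv
    have h3 : ContDiffOn ℝ ∞ (fun z => ((G (φ z)).comp (fderiv ℝ φ z)).flip) V :=
      (ContinuousLinearMap.flipₗᵢ ℝ F' F ℝ).contDiff.comp_contDiffOn (h1.clm_comp h2)
    exact (ContinuousLinearMap.flipₗᵢ ℝ F' F' ℝ).contDiff.comp_contDiffOn (h3.clm_comp h2)
  symm z hz v w := hG.symm _ (hφ.mapsTo hz) _ _
  pos z hz v hv := hG.pos _ (hφ.mapsTo hz) _ fun h =>
    hv (hφ.injective z hz (h.trans (map_zero _).symm))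

theorem snd_fderiv_symm (hφ : IsImmersionOn φ V U) (hz : z ∈ V) (v w : F') :
    fderiv ℝ (fderiv ℝ φ) z v w = fderiv ℝ (fderiv ℝ φ) z w v := by
  have h : IsSymmSndFDerivAt ℝ φ z :=
    (hφ.contDiffOn.contDiffAt (hφ.mem_nhds hz)).isSymmSndFDerivAt (by simpa using two_le_infty)
  exact h.eq v w

theorem trd_fderiv_symm (hφ : IsImmersionOn φ V U) (hz : z ∈ V) (x y w : F') :
    fderiv ℝ (fderiv ℝ (fderiv ℝ φ)) z x y w = fderiv ℝ (fderiv ℝ (fderiv ℝ φ)) z y x w := by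
  have h : IsSymmSndFDerivAt ℝ (fderiv ℝ φ) z :=
    (hφ.contDiffOn_fderiv.contDiffAt (hφ.mem_nhds hz)).isSymmSndFDerivAt
      (by simpa using two_le_infty)
  rw [h.eq x y]

variable [FiniteDimensional ℝ F]

/-- The lowered Christoffel symbols of a pull-back metric are the tangential part of the covariant
Hessian. -/
theorem koszul_pull (hφ : IsImmersionOn φ V U) (hG : IsMetricOn G U) (hz : z ∈ V) (v w y : F') :
    koszul (pull G φ) z v w y = G (φ z) (covHess G φ z v w) (fderiv ℝ φ z y) := by
  have hP := hφ.isMetricOn_pull hG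
  have hzU := hφ.mapsTo hz
  have d1 := hφ.differentiableAt_of_contDiffOn hφ.contDiffOn hz
  have d2 := hφ.differentiableAt_of_contDiffOn hφ.contDiffOn_fderiv hz
  have key : ∀ a b c : F', fderiv ℝ (pull G φ) z a b c =
      fderiv ℝ G (φ z) (fderiv ℝ φ z a) (fderiv ℝ φ z b) (fderiv ℝ φ z c) +
      G (φ z) (fderiv ℝ (fderiv ℝ φ) z a b) (fderiv ℝ φ z c) +
      G (φ z) (fderiv ℝ φ z b) (fderiv ℝ (fderiv ℝ φ) z a c) := by
    intro a b c
    have h1 := ((hasDerivAt_line (hP.differentiableAt hz) a).clm_apply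
      (hasDerivAt_const 0 b)).clm_apply (hasDerivAt_const 0 c)
    have h2 := ((hasDerivAt_comp_line (hG.differentiableAt hzU) d1 a).clm_apply
      ((hasDerivAt_line d2 a).clm_apply (hasDerivAt_const 0 b))).clm_apply
      ((hasDerivAt_line d2 a).clm_apply (hasDerivAt_const 0 c))
    simpa using h1.unique h2
  rw [koszul_apply, key, key, key, covHess, map_add, add_apply, hG.apply_christoffel hzU,
    koszul_apply, hφ.snd_fderiv_symm hz w v, hφ.snd_fderiv_symm hz y v,
    hφ.snd_fderiv_symm hz y w, hG.symm _ hzU (fderiv ℝ (fderiv ℝ φ) z v y)]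
  ring

/-- The Gauss equation for an isometric immersion `φ`, in a form which does not mention the second
fundamental form `∇dφ - dφ ∘ Γ'`. -/
theorem apply_curv_pull [FiniteDimensional ℝ F'] (hφ : IsImmersionOn φ V U) (hG : IsMetricOn G U)
    (hz : z ∈ V) (x y w v : F') :
    pull G φ z (curv (pull G φ) z x y w) v =
      G (φ z) (curv G (φ z) (fderiv ℝ φ z x) (fderiv ℝ φ z y) (fderiv ℝ φ z w)) (fderiv ℝ φ z v)
      + G (φ z) (covHess G φ z y w) (covHess G φ z x v)
      - G (φ z) (covHess G φ z x w) (covHess G φ z y v)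
      - pull G φ z (christoffel (pull G φ) z x v) (christoffel (pull G φ) z y w)
      + pull G φ z (christoffel (pull G φ) z y v) (christoffel (pull G φ) z x w) := by
  have hP := hφ.isMetricOn_pull hG
  have hzU := hφ.mapsTo hz
  have d1 := hφ.differentiableAt_of_contDiffOn hφ.contDiffOn hz
  have d2 := hφ.differentiableAt_of_contDiffOn hφ.contDiffOn_fderiv hz
  have d3 := hφ.differentiableAt_of_contDiffOn hφ.contDiffOn_snd_fderiv hz
  have dc := hG.differentiableAt_of_contDiffOn hG.contDiffOn_christoffel hzU
  have dk := hP.differentiableAt_of_contDiffOn hP.contDiffOn_koszul hz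
  have key : ∀ a b c : F', fderiv ℝ (koszul (pull G φ)) z a b c v =
      fderiv ℝ G (φ z) (fderiv ℝ φ z a) (covHess G φ z b c) (fderiv ℝ φ z v) +
      G (φ z) (fderiv ℝ (fderiv ℝ (fderiv ℝ φ)) z a b c +
        (fderiv ℝ (christoffel G) (φ z) (fderiv ℝ φ z a) (fderiv ℝ φ z b) (fderiv ℝ φ z c)
        + christoffel G (φ z) (fderiv ℝ (fderiv ℝ φ) z a b) (fderiv ℝ φ z c)
        + christoffel G (φ z) (fderiv ℝ φ z b) (fderiv ℝ (fderiv ℝ φ) z a c))) (fderiv ℝ φ z v) +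
      G (φ z) (covHess G φ z b c) (fderiv ℝ (fderiv ℝ φ) z a v) := by
    intro a b c
    have e := fun u : F' => (hasDerivAt_line d2 a).clm_apply (hasDerivAt_const 0 u)
    have h1 := (((hasDerivAt_line dk a).clm_apply (hasDerivAt_const 0 b)).clm_apply
      (hasDerivAt_const 0 c)).clm_apply (hasDerivAt_const 0 v)
    have h2 := ((hasDerivAt_comp_line (hG.differentiableAt hzU) d1 a).clm_apply
      ((((hasDerivAt_line d3 a).clm_apply (hasDerivAt_const 0 b)).clm_apply
        (hasDerivAt_const 0 c)).add
        (((hasDerivAt_comp_line dc d1 a).clm_apply (e b)).clm_apply (e c)))).clm_apply (e v)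
    have h3 := h1.unique (h2.congr_of_eventuallyEq (by
      filter_upwards [(tendsto_line z a).eventually (hφ.mem_nhds hz)] with t ht
      exact hφ.koszul_pull hG ht b c v))
    simpa [covHess] using h3
  rw [hP.apply_curv hz, key, key, hG.fderiv_eq_christoffel hzU, hG.fderiv_eq_christoffel hzU,
    hφ.trd_fderiv_symm hz y x w, hφ.snd_fderiv_symm hz y x]
  simp only [curv, covHess, map_add, map_sub, add_apply, sub_apply]
  ring

/-- The covariant Hessian of an isometry is `dφ ∘ Γ'`: this is the transformation law of the
Christoffel symbols. -/
theorem covHess_eq_of_surjective [FiniteDimensional ℝ F'] (hφ : IsImmersionOn φ V U)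
    (hG : IsMetricOn G U) (hz : z ∈ V) (hs : Function.Surjective (fderiv ℝ φ z)) (v w : F') :
    covHess G φ z v w = fderiv ℝ φ z (christoffel (pull G φ) z v w) := by
  refine hG.eq_of_forall (hφ.mapsTo hz) fun y => ?_
  obtain ⟨y, rfl⟩ := hs y
  rw [← hφ.koszul_pull hG hz, ← (hφ.isMetricOn_pull hG).apply_christoffel hz, pull_apply]

/-- The curvature tensor is invariant under isometries. -/
theorem apply_curv_pull_of_surjective [FiniteDimensional ℝ F'] (hφ : IsImmersionOn φ V U)
    (hG : IsMetricOn G U) (hz : z ∈ V) (hs : Function.Surjective (fderiv ℝ φ z)) (x y w v : F') :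
    pull G φ z (curv (pull G φ) z x y w) v =
      G (φ z) (curv G (φ z) (fderiv ℝ φ z x) (fderiv ℝ φ z y) (fderiv ℝ φ z w))
        (fderiv ℝ φ z v) := by
  rw [hφ.apply_curv_pull hG hz]
  simp only [hφ.covHess_eq_of_surjective hG hz hs, pull_apply]
  rw [hG.symm _ (hφ.mapsTo hz) (fderiv ℝ φ z (christoffel (pull G φ) z y w)),
    hG.symm _ (hφ.mapsTo hz) (fderiv ℝ φ z (christoffel (pull G φ) z x w))]
  ring

end IsImmersionOn

end Gauss

/-! ### Germs -/

section Germs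

variable {F : Type*} [NormedAddCommGroup F] [NormedSpace ℝ F]
  {G G' : F → F →L[ℝ] F →L[ℝ] ℝ} {z : F}

theorem christoffel_congr (h : G =ᶠ[𝓝 z] G') : christoffel G z = christoffel G' z := by
  simp only [christoffel, koszul, h.fderiv_eq, h.eq_of_nhds]

theorem curv_congr (h : G =ᶠ[𝓝 z] G') (x y w : F) : curv G z x y w = curv G' z x y w := by
  have h1 : christoffel G =ᶠ[𝓝 z] christoffel G' :=
    h.eventually_nhds.mono fun _ h => christoffel_congr h
  simp only [curv, h1.fderiv_eq, h1.eq_of_nhds]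

theorem ric_congr (h : G =ᶠ[𝓝 z] G') : ric G z = ric G' z := by
  ext y w
  have : curvLin G z y w = curvLin G' z y w := by
    ext x; exact curv_congr h x y w
  simp only [ric, LinearMap.mk₂_apply, this]

theorem scal_congr [FiniteDimensional ℝ F] (h : G =ᶠ[𝓝 z] G') : scal G z = scal G' z := by
  simp only [scal, ricEnd, ric_congr h, h.eq_of_nhds]

end Germs

/-! ### Ricci and scalar curvature in orthonormal bases -/

section Traces

variable {F : Type*} [NormedAddCommGroup F] [NormedSpace ℝ F]

/-- The family `e` is orthonormal for the inner product `B`. -/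
def OrthonormalFor {ι : Type*} [DecidableEq ι] (B : F →L[ℝ] F →L[ℝ] ℝ) (e : ι → F) : Prop :=
  ∀ i j, B (e i) (e j) = if i = j then 1 else 0

theorem OrthonormalFor.apply_eq {ι : Type*} [DecidableEq ι] {B : F →L[ℝ] F →L[ℝ] ℝ} {e : ι → F}
    (he : OrthonormalFor B e) (i j : ι) : B (e i) (e j) = if i = j then 1 else 0 := he i j

theorem OrthonormalFor.repr_eq {ι : Type*} [Fintype ι] [DecidableEq ι]
    {B : F →L[ℝ] F →L[ℝ] ℝ} {e : Module.Basis ι ℝ F} (he : OrthonormalFor B e) (v : F) (i : ι) :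
    e.repr v i = B v (e i) := by
  have h : B (∑ k, e.repr v k • e k) (e i) = e.repr v i := by
    simp [-Module.Basis.sum_repr, map_sum, he.apply_eq, sum_apply]
  rw [← h, e.sum_repr]

theorem OrthonormalFor.symm {ι : Type*} [Fintype ι] [DecidableEq ι]
    {B : F →L[ℝ] F →L[ℝ] ℝ} {e : Module.Basis ι ℝ F} (he : OrthonormalFor B e) (v : F) (i : ι) :
    B (e i) v = B v (e i) := by
  have h : B (e i) (∑ k, e.repr v k • e k) = e.repr v i := by
    simp [-Module.Basis.sum_repr, map_sum, he.apply_eq]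
  rw [← he.repr_eq, ← h, e.sum_repr]

theorem OrthonormalFor.eq_sum {ι : Type*} [Fintype ι] [DecidableEq ι]
    {B : F →L[ℝ] F →L[ℝ] ℝ} {e : Module.Basis ι ℝ F} (he : OrthonormalFor B e) (v : F) :
    v = ∑ i, B v (e i) • e i := by
  simp only [← he.repr_eq, e.sum_repr]

theorem OrthonormalFor.linearIndependent {ι : Type*} [DecidableEq ι]
    {B : F →L[ℝ] F →L[ℝ] ℝ} {e : ι → F} (he : OrthonormalFor B e) : LinearIndependent ℝ e := by
  rw [linearIndependent_iff']
  intro s c hc i hi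
  have := congrArg (fun v => B v (e i)) hc
  simpa [map_sum, sum_apply, he.apply_eq, hi] using this

theorem OrthonormalFor.trace_eq {ι : Type*} [Fintype ι] [DecidableEq ι]
    {B : F →L[ℝ] F →L[ℝ] ℝ} {e : Module.Basis ι ℝ F} (he : OrthonormalFor B e) (L : F →ₗ[ℝ] F) :
    LinearMap.trace ℝ F L = ∑ i, B (L (e i)) (e i) := by
  rw [LinearMap.trace_eq_matrix_trace ℝ e, Matrix.trace]
  refine Finset.sum_congr rfl fun i _ => ?_
  rw [Matrix.diag_apply, LinearMap.toMatrix_apply]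
  exact he.repr_eq _ _

/-- Parseval's identity for the trace of a bilinear form: it can be computed in any orthonormal
basis. -/
theorem OrthonormalFor.sum_eq_sum {ι κ : Type*} [Fintype ι] [DecidableEq ι] [Fintype κ]
    [DecidableEq κ] {B : F →L[ℝ] F →L[ℝ] ℝ} {e : Module.Basis ι ℝ F} (he : OrthonormalFor B e)
    {f : Module.Basis κ ℝ F} (hf : OrthonormalFor B f) (T : F → F → ℝ)
    (hadd : ∀ a b c, T (a + b) c = T a c + T b c) (hsmul : ∀ (r : ℝ) a c, T (r • a) c = r * T a c)
    (hadd' : ∀ a b c, T c (a + b) = T c a + T c b)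
    (hsmul' : ∀ (r : ℝ) a c, T c (r • a) = r * T c a) :
    ∑ i, T (e i) (e i) = ∑ j, T (f j) (f j) := by
  let T' : F →ₗ[ℝ] F →ₗ[ℝ] ℝ := LinearMap.mk₂ ℝ T hadd hsmul (fun c a b => hadd' a b c)
    (fun r c a => hsmul' r a c)
  have hT : ∀ a b, T a b = T' a b := fun a b => rfl
  -- `L` represents `T` in the basis `e`
  let L : F →ₗ[ℝ] F := ∑ k, (T'.flip (e k)).smulRight (e k)
  have hL : ∀ a, ∀ b, B (L a) b = T a b := by
    intro a b
    conv_rhs => rw [he.eq_sum b, hT]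
    simp [L, map_sum, sum_apply, LinearMap.sum_apply, he.symm, mul_comm]
  rw [← Finset.sum_congr rfl fun i _ => hL (e i) (e i), ← he.trace_eq L, hf.trace_eq L]
  simp only [hL]

variable {G : F → F →L[ℝ] F →L[ℝ] ℝ} {U : Set F} {z : F}

theorem exists_orthonormalFor [FiniteDimensional ℝ F] {B : F →L[ℝ] F →L[ℝ] ℝ}
    (hs : ∀ v w, B v w = B w v) (hp : ∀ v, v ≠ 0 → 0 < B v v) :
    ∃ e : Module.Basis (Fin (Module.finrank ℝ F)) ℝ F, OrthonormalFor B e := by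
  let B' : LinearMap.BilinForm ℝ F := LinearMap.mk₂ ℝ (fun a b => B a b)
    (by simp) (by simp) (by simp) (by simp)
  have hB' : LinearMap.IsSymm B' := ⟨fun v w => hs v w⟩
  obtain ⟨v, hv⟩ := LinearMap.BilinForm.exists_orthogonal_basis hB'
  have hpos : ∀ i, 0 < B (v i) (v i) := fun i => hp _ (v.ne_zero i)
  refine ⟨v.isUnitSMul (w := fun i => (Real.sqrt (B (v i) (v i)))⁻¹) fun i =>
    (inv_ne_zero (Real.sqrt_pos.2 (hpos i)).ne').isUnit, fun i j => ?_⟩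
  rw [Module.Basis.isUnitSMul_apply, Module.Basis.isUnitSMul_apply]
  split_ifs with h
  · subst h
    have h2 := Real.mul_self_sqrt (hpos i).le
    have h3 := (Real.sqrt_pos.2 (hpos i)).ne'
    simp only [map_smul, smul_apply, smul_eq_mul]
    field_simp
    nlinarith
  · have : B (v i) (v j) = 0 := hv h
    simp [this]

theorem ric_eq_sum {ι : Type*} [Fintype ι] [DecidableEq ι] {e : Module.Basis ι ℝ F}
    (he : OrthonormalFor (G z) e) (y w : F) :
    ric G z y w = ∑ i, G z (curv G z (e i) y w) (e i) := by
  simp only [ric, LinearMap.mk₂_apply]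
  rw [he.trace_eq]
  rfl

theorem scal_eq_sum_ric [FiniteDimensional ℝ F] (hG : IsMetricOn G U) (hz : z ∈ U) {ι : Type*}
    [Fintype ι] [DecidableEq ι] {e : Module.Basis ι ℝ F} (he : OrthonormalFor (G z) e) :
    scal G z = ∑ j, ric G z (e j) (e j) := by
  rw [scal, he.trace_eq]
  refine Finset.sum_congr rfl fun j _ => ?_
  have := hG.apply_inverse hz (LinearMap.toContinuousLinearMap (ric G z (e j)))
  exact congrArg (fun l : F →L[ℝ] ℝ => l (e j)) this

end Traces

/-! ### The Sasaki metric in coordinates -/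

namespace IsMetricOn

variable {F : Type*} [NormedAddCommGroup F] [NormedSpace ℝ F] [FiniteDimensional ℝ F]
  {G : F → F →L[ℝ] F →L[ℝ] ℝ} {U : Set F} {z : F}

theorem apply_curv_sectional (hG : IsMetricOn G U) (hz : z ∈ U) (x y : F) :
    G z (curv G z x y y) x = fderiv ℝ (fderiv ℝ G) z x y x y
      - 1 / 2 * fderiv ℝ (fderiv ℝ G) z x x y y - 1 / 2 * fderiv ℝ (fderiv ℝ G) z y y x x
      - G z (christoffel G z x x) (christoffel G z y y)
      + G z (christoffel G z x y) (christoffel G z x y) := by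
  rw [hG.apply_curv hz, hG.fderiv_koszul hz, hG.fderiv_koszul hz, hG.christoffel_symm z hz y x]
  have h := hG.snd_fderiv_symm hz
  have h' := hG.snd_fderiv_symm' hz
  linarith [h y x y x, h' x y y x, h y x x y]

theorem fderiv_christoffel_of_eq_zero (hG : IsMetricOn G U) (hz : z ∈ U)
    (h0 : christoffel G z = 0) (x v w y : F) :
    G z (fderiv ℝ (christoffel G) z x v w) y =
      (1 / 2) * (fderiv ℝ (fderiv ℝ G) z x v w y + fderiv ℝ (fderiv ℝ G) z x w v y
        - fderiv ℝ (fderiv ℝ G) z x y v w) := by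
  have hk := hG.differentiableAt_of_contDiffOn hG.contDiffOn_koszul hz
  have hc := hG.differentiableAt_of_contDiffOn hG.contDiffOn_christoffel hz
  have h1 := (((hasDerivAt_line hk x).clm_apply (hasDerivAt_const 0 v)).clm_apply
    (hasDerivAt_const 0 w)).clm_apply (hasDerivAt_const 0 y)
  have h2 := ((hasDerivAt_line (hG.differentiableAt hz) x).clm_apply
    (((hasDerivAt_line hc x).clm_apply (hasDerivAt_const 0 v)).clm_apply
    (hasDerivAt_const 0 w))).clm_apply (hasDerivAt_const 0 y)
  have h3 := h1.unique (h2.congr_of_eventuallyEq (by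
    filter_upwards [(tendsto_line z x).eventually (hG.mem_nhds hz)] with t ht
    exact (hG.apply_christoffel ht v w y).symm))
  rw [← hG.fderiv_koszul hz]
  simpa [h0] using h3.symm

theorem fderiv_eq_zero (hG : IsMetricOn G U) (hz : z ∈ U) (h0 : christoffel G z = 0) :
    fderiv ℝ G z = 0 := by
  ext x v w
  rw [hG.fderiv_eq_christoffel hz, h0]
  simp

end IsMetricOn

section Sasaki

variable {E : Type*} [NormedAddCommGroup E] [NormedSpace ℝ E]

/-- The connection map `(a, b) ↦ b + Γ(a, u)` at the tangent vector `p = (x, u)`. -/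
def coordConn (g : E → E →L[ℝ] E →L[ℝ] ℝ) (p : E × E) : E × E →L[ℝ] E :=
  ContinuousLinearMap.snd ℝ E E +
    ((christoffel g p.1).flip p.2) ∘L ContinuousLinearMap.fst ℝ E E

/-- The weighted Sasaki metric of a metric `g` on an open subset of the vector space `E`. -/
def coordSasaki (g : E → E →L[ℝ] E →L[ℝ] ℝ) (f₁ f₂ : ℝ) (p : E × E) :
    E × E →L[ℝ] E × E →L[ℝ] ℝ :=
  f₁ • (g p.1).bilinearComp (ContinuousLinearMap.fst ℝ E E) (ContinuousLinearMap.fst ℝ E E) +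
    f₂ • (g p.1).bilinearComp (coordConn g p) (coordConn g p)

variable {g : E → E →L[ℝ] E →L[ℝ] ℝ} {U : Set E} {x u : E} {f₁ f₂ : ℝ}

theorem coordConn_apply (g : E → E →L[ℝ] E →L[ℝ] ℝ) (p X : E × E) :
    coordConn g p X = X.2 + christoffel g p.1 X.1 p.2 := by simp [coordConn]

theorem coordSasaki_apply (g : E → E →L[ℝ] E →L[ℝ] ℝ) (f₁ f₂ : ℝ) (p X Y : E × E) :
    coordSasaki g f₁ f₂ p X Y = f₁ * g p.1 X.1 Y.1 +
      f₂ * g p.1 (X.2 + christoffel g p.1 X.1 p.2) (Y.2 + christoffel g p.1 Y.1 p.2) := by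
  simp [coordSasaki, coordConn_apply]

variable [FiniteDimensional ℝ E]

theorem IsMetricOn.coordSasaki (hg : IsMetricOn g U) (h₁ : 0 < f₁) (h₂ : 0 < f₂) :
    IsMetricOn (coordSasaki g f₁ f₂) (U ×ˢ univ) where
  isOpen := hg.isOpen.prod isOpen_univ
  contDiffOn := by
    have hfst : MapsTo (Prod.fst : E × E → E) (U ×ˢ univ) U := fun p hp => hp.1
    have hgp : ContDiffOn ℝ ∞ (fun p : E × E => g p.1) (U ×ˢ univ) :=
      hg.contDiffOn.comp contDiff_fst.contDiffOn hfst
    have hcp : ContDiffOn ℝ ∞ (fun p : E × E => christoffel g p.1) (U ×ˢ univ) :=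
      hg.contDiffOn_christoffel.comp contDiff_fst.contDiffOn hfst
    have hconn : ContDiffOn ℝ ∞ (coordConn g) (U ×ˢ univ) :=
      contDiffOn_const.add ((((ContinuousLinearMap.flipₗᵢ ℝ E E E).contDiff.comp_contDiffOn
        hcp).clm_apply contDiff_snd.contDiffOn).clm_comp contDiffOn_const)
    have hb : ∀ {L : E × E → E × E →L[ℝ] E}, ContDiffOn ℝ ∞ L (U ×ˢ univ) →
        ContDiffOn ℝ ∞ (fun p => (g p.1).bilinearComp (L p) (L p)) (U ×ˢ univ) := by
      intro L hL
      have h3 : ContDiffOn ℝ ∞ (fun p => ((g p.1).comp (L p)).flip) (U ×ˢ univ) :=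
        (ContinuousLinearMap.flipₗᵢ ℝ (E × E) E ℝ).contDiff.comp_contDiffOn (hgp.clm_comp hL)
      exact (ContinuousLinearMap.flipₗᵢ ℝ (E × E) (E × E) ℝ).contDiff.comp_contDiffOn
        (h3.clm_comp hL)
    exact ((hb contDiffOn_const).const_smul f₁).add ((hb hconn).const_smul f₂)
  symm p hp X Y := by
    rw [coordSasaki_apply, coordSasaki_apply, hg.symm _ hp.1 X.1,
      hg.symm _ hp.1 (X.2 + _)]
  pos p hp X hX := by
    rw [coordSasaki_apply]
    rcases eq_or_ne X.1 0 with h | h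
    · have h' : X.2 ≠ 0 := fun h' => hX (Prod.ext h h')
      simpa [h] using mul_pos h₂ (hg.pos _ hp.1 _ h')
    · exact add_pos_of_pos_of_nonneg (mul_pos h₁ (hg.pos _ hp.1 _ h))
        (mul_nonneg h₂.le (hg.nonneg hp.1 _))

theorem fderiv_coordSasaki (hg : IsMetricOn g U) (h₁ : 0 < f₁) (h₂ : 0 < f₂)
    (hx : x ∈ U) (u : E) (X Z W : E × E) :
    fderiv ℝ (coordSasaki g f₁ f₂) (x, u) X Z W = f₁ * fderiv ℝ g x X.1 Z.1 W.1 +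
      f₂ * (fderiv ℝ g x X.1 (Z.2 + christoffel g x Z.1 u) (W.2 + christoffel g x W.1 u)
        + g x (fderiv ℝ (christoffel g) x X.1 Z.1 u + christoffel g x Z.1 X.2)
            (W.2 + christoffel g x W.1 u)
        + g x (Z.2 + christoffel g x Z.1 u)
            (fderiv ℝ (christoffel g) x X.1 W.1 u + christoffel g x W.1 X.2)) := by
  have hS := hg.coordSasaki h₁ h₂
  have hz : (x, u) ∈ U ×ˢ (univ : Set E) := ⟨hx, trivial⟩
  have hc := hg.differentiableAt_of_contDiffOn hg.contDiffOn_christoffel hx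
  have h1 := ((hasDerivAt_line (hS.differentiableAt hz) X).clm_apply
    (hasDerivAt_const 0 Z)).clm_apply (hasDerivAt_const 0 W)
  have hΓ := fun a : E => ((hasDerivAt_line hc X.1).clm_apply (hasDerivAt_const 0 a)).clm_apply
    (hasDerivAt_add_smul u X.2)
  have hd := hasDerivAt_line (hg.differentiableAt hx) X.1
  have h2 := (((hd.clm_apply (hasDerivAt_const 0 Z.1)).clm_apply
    (hasDerivAt_const 0 W.1)).const_mul f₁).add
    (((hd.clm_apply ((hΓ Z.1).const_add Z.2)).clm_apply ((hΓ W.1).const_add W.2)).const_mul f₂)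
  have h3 := h1.unique (h2.congr_of_eventuallyEq (Eventually.of_forall fun t => by
    simp [coordSasaki_apply]))
  simpa using h3

/-- The second derivatives of the Sasaki metric, where the Christoffel symbols vanish. -/
theorem snd_fderiv_coordSasaki (hg : IsMetricOn g U) (h₁ : 0 < f₁) (h₂ : 0 < f₂)
    (hx : x ∈ U) (h0 : christoffel g x = 0) (u : E) (X Y Z W : E × E) :
    fderiv ℝ (fderiv ℝ (coordSasaki g f₁ f₂)) (x, u) Y X Z W =
      f₁ * fderiv ℝ (fderiv ℝ g) x Y.1 X.1 Z.1 W.1 +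
      f₂ * (fderiv ℝ (fderiv ℝ g) x Y.1 X.1 Z.2 W.2
        + g x (fderiv ℝ (fderiv ℝ (christoffel g)) x Y.1 X.1 Z.1 u +
            fderiv ℝ (christoffel g) x X.1 Z.1 Y.2 + fderiv ℝ (christoffel g) x Y.1 Z.1 X.2) W.2
        + g x Z.2 (fderiv ℝ (fderiv ℝ (christoffel g)) x Y.1 X.1 W.1 u +
            fderiv ℝ (christoffel g) x X.1 W.1 Y.2 + fderiv ℝ (christoffel g) x Y.1 W.1 X.2)
        + g x (fderiv ℝ (christoffel g) x X.1 Z.1 u) (fderiv ℝ (christoffel g) x Y.1 W.1 u)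
        + g x (fderiv ℝ (christoffel g) x Y.1 Z.1 u) (fderiv ℝ (christoffel g) x X.1 W.1 u)) := by
  have hS := hg.coordSasaki h₁ h₂
  have hz : (x, u) ∈ U ×ˢ (univ : Set E) := ⟨hx, trivial⟩
  have hg0 := hg.fderiv_eq_zero hx h0
  have hc := hg.differentiableAt_of_contDiffOn hg.contDiffOn_christoffel hx
  have hc2 := hg.differentiableAt_of_contDiffOn
    (hg.contDiffOn_christoffel.fderiv_of_isOpen hg.isOpen (m := ∞) (by simp)) hx
  have hg2 := hg.differentiableAt_of_contDiffOn hg.contDiffOn_fderiv hx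
  have h1 := (((hasDerivAt_line (hS.differentiableAt_of_contDiffOn hS.contDiffOn_fderiv hz)
    Y).clm_apply (hasDerivAt_const 0 X)).clm_apply
    (hasDerivAt_const 0 Z)).clm_apply (hasDerivAt_const 0 W)
  have hu := hasDerivAt_add_smul u Y.2
  have hc1 := hasDerivAt_line hc Y.1
  have hΓ := fun a : E => (hc1.clm_apply (hasDerivAt_const 0 a)).clm_apply hu
  have hΓ' := fun a : E => (((hasDerivAt_line hc2 Y.1).clm_apply
    (hasDerivAt_const 0 X.1)).clm_apply (hasDerivAt_const 0 a)).clm_apply hu |>.add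
      ((hc1.clm_apply (hasDerivAt_const 0 a)).clm_apply (hasDerivAt_const 0 X.2))
  have hd := hasDerivAt_line (hg.differentiableAt hx) Y.1
  have hd2 := (hasDerivAt_line hg2 Y.1).clm_apply (hasDerivAt_const 0 X.1)
  have h2 := (((hd2.clm_apply (hasDerivAt_const 0 Z.1)).clm_apply
    (hasDerivAt_const 0 W.1)).const_mul f₁).add
    (((((hd2.clm_apply ((hΓ Z.1).const_add Z.2)).clm_apply ((hΓ W.1).const_add W.2)).add
      ((hd.clm_apply (hΓ' Z.1)).clm_apply ((hΓ W.1).const_add W.2))).add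
      ((hd.clm_apply ((hΓ Z.1).const_add Z.2)).clm_apply (hΓ' W.1))).const_mul f₂)
  have h3 := h1.unique (h2.congr_of_eventuallyEq (by
    filter_upwards [(tendsto_line (x, u) Y).eventually (hS.mem_nhds hz)] with t ht
    exact fderiv_coordSasaki hg h₁ h₂ ht.1 (u + t • Y.2) X Z W))
  simp only [zero_smul, add_zero, hg0, h0, _root_.zero_apply, map_zero, zero_add,
    Pi.add_apply, add_apply, map_add] at h3 ⊢
  rw [h3]
  ring

/-- Where the Christoffel symbols of `g` vanish, those of the Sasaki metric on horizontal vectors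
are vertical. -/
theorem christoffel_coordSasaki_horizontal (hg : IsMetricOn g U) (h₁ : 0 < f₁) (h₂ : 0 < f₂)
    (hx : x ∈ U) (h0 : christoffel g x = 0) (u a a' : E) :
    christoffel (coordSasaki g f₁ f₂) (x, u) (a, 0) (a', 0) =
      (0, (1 / 2 : ℝ) • (fderiv ℝ (christoffel g) x a a' u +
        fderiv ℝ (christoffel g) x a' a u)) := by
  have hS := hg.coordSasaki h₁ h₂
  have hz : (x, u) ∈ U ×ˢ (univ : Set E) := ⟨hx, trivial⟩
  have hg0 := hg.fderiv_eq_zero hx h0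
  refine hS.eq_of_forall hz fun Y => ?_
  rw [hS.apply_christoffel hz, koszul_apply]
  simp only [fderiv_coordSasaki hg h₁ h₂ hx, coordSasaki_apply, h0, hg0]
  simp
  ring

/-- Where the Christoffel symbols of `g` vanish, so does the Christoffel term of `∇_X N`, for the
Liouville field `N = (0, u)`. -/
theorem christoffel_coordSasaki_liouville (hg : IsMetricOn g U) (h₁ : 0 < f₁) (h₂ : 0 < f₂)
    (hx : x ∈ U) (h0 : christoffel g x = 0) (u : E) (X : E × E) :
    christoffel (coordSasaki g f₁ f₂) (x, u) X (0, u) = 0 := by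
  have hS := hg.coordSasaki h₁ h₂
  have hz : (x, u) ∈ U ×ˢ (univ : Set E) := ⟨hx, trivial⟩
  have hg0 := hg.fderiv_eq_zero hx h0
  refine hS.eq_of_forall hz fun Y => ?_
  have h := fun a b : E => hg.fderiv_christoffel_of_eq_zero hx h0 a b u u
  rw [hS.apply_christoffel hz, koszul_apply]
  simp only [fderiv_coordSasaki hg h₁ h₂ hx, coordSasaki_apply, h0, hg0]
  simp [h, hg.symm x hx u, hg.snd_fderiv_symm hx X.1 Y.1]

theorem christoffel_coordSasaki_vertical (hg : IsMetricOn g U) (h₁ : 0 < f₁) (h₂ : 0 < f₂)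
    (hx : x ∈ U) (h0 : christoffel g x = 0) (u b b' : E) :
    christoffel (coordSasaki g f₁ f₂) (x, u) (0, b) (0, b') = 0 := by
  have hS := hg.coordSasaki h₁ h₂
  have hz : (x, u) ∈ U ×ˢ (univ : Set E) := ⟨hx, trivial⟩
  have hg0 := hg.fderiv_eq_zero hx h0
  refine hS.eq_of_forall hz fun Y => ?_
  rw [hS.apply_christoffel hz, koszul_apply]
  simp only [fderiv_coordSasaki hg h₁ h₂ hx, coordSasaki_apply, h0, hg0]
  simp

/-- O'Neill's formula for the sectional curvatures of horizontal planes, where the Christoffel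
symbols vanish. -/
theorem curv_coordSasaki_horizontal_aux (hg : IsMetricOn g U) (h₁ : 0 < f₁) (h₂ : 0 < f₂)
    (hx : x ∈ U) (h0 : christoffel g x = 0) (u a a' : E) :
    coordSasaki g f₁ f₂ (x, u) (curv (coordSasaki g f₁ f₂) (x, u) (a, 0) (a', 0) (a', 0)) (a, 0) =
      f₁ * g x (curv g x a a' a') a
        - 3 / 4 * f₂ * g x (curv g x a a' u) (curv g x a a' u) := by
  have hS := hg.coordSasaki h₁ h₂
  have hz : (x, u) ∈ U ×ˢ (univ : Set E) := ⟨hx, trivial⟩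
  rw [hS.apply_curv_sectional hz, hg.apply_curv_sectional hx]
  simp only [snd_fderiv_coordSasaki hg h₁ h₂ hx h0,
    christoffel_coordSasaki_horizontal hg h₁ h₂ hx h0, coordSasaki_apply, curv, h0]
  simp
  rw [hg.symm x hx (fderiv ℝ (christoffel g) x a' a u)]
  ring

/-- The curvatures of mixed planes are nonnegative: the second derivatives cancel, the square of a
Christoffel symbol remains. -/
theorem curv_coordSasaki_mixed_aux (hg : IsMetricOn g U) (h₁ : 0 < f₁) (h₂ : 0 < f₂)
    (hx : x ∈ U) (h0 : christoffel g x = 0) (u a b : E) :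
    0 ≤ coordSasaki g f₁ f₂ (x, u)
      (curv (coordSasaki g f₁ f₂) (x, u) (a, 0) (0, b) (0, b)) (a, 0) := by
  have hS := hg.coordSasaki h₁ h₂
  have hz : (x, u) ∈ U ×ˢ (univ : Set E) := ⟨hx, trivial⟩
  have h := hg.fderiv_christoffel_of_eq_zero hx h0 a a b b
  rw [hS.apply_curv_sectional hz]
  simp only [snd_fderiv_coordSasaki hg h₁ h₂ hx h0,
    christoffel_coordSasaki_vertical hg h₁ h₂ hx h0]
  have h' := hS.nonneg hz (christoffel (coordSasaki g f₁ f₂) (x, u) (a, 0) (0, b))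
  simp [h]
  linarith

theorem curv_coordSasaki_vertical_aux (hg : IsMetricOn g U) (h₁ : 0 < f₁) (h₂ : 0 < f₂)
    (hx : x ∈ U) (h0 : christoffel g x = 0) (u b b' : E) :
    coordSasaki g f₁ f₂ (x, u)
      (curv (coordSasaki g f₁ f₂) (x, u) (0, b) (0, b') (0, b')) (0, b) = 0 := by
  have hS := hg.coordSasaki h₁ h₂
  have hz : (x, u) ∈ U ×ˢ (univ : Set E) := ⟨hx, trivial⟩
  rw [hS.apply_curv_sectional hz]
  simp only [snd_fderiv_coordSasaki hg h₁ h₂ hx h0,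
    christoffel_coordSasaki_vertical hg h₁ h₂ hx h0]
  simp

theorem curv_coordSasaki_liouville_aux (hg : IsMetricOn g U) (h₁ : 0 < f₁) (h₂ : 0 < f₂)
    (hx : x ∈ U) (h0 : christoffel g x = 0) (u : E) (X : E × E) :
    coordSasaki g f₁ f₂ (x, u)
      (curv (coordSasaki g f₁ f₂) (x, u) X (0, u) (0, u)) X = 0 := by
  have hS := hg.coordSasaki h₁ h₂
  have hz : (x, u) ∈ U ×ˢ (univ : Set E) := ⟨hx, trivial⟩
  have h := hg.fderiv_christoffel_of_eq_zero hx h0 X.1 X.1 u u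
  rw [hS.apply_curv_sectional hz]
  simp only [snd_fderiv_coordSasaki hg h₁ h₂ hx h0,
    christoffel_coordSasaki_liouville hg h₁ h₂ hx h0]
  simp [h]
  ring

end Sasaki

/-! ### Tangent maps and normal coordinates -/

section TangentMaps

variable {E : Type*} [NormedAddCommGroup E] [NormedSpace ℝ E]
  {E' : Type*} [NormedAddCommGroup E'] [NormedSpace ℝ E']

/-- The tangent map `(y, v) ↦ (φ y, dφ_y v)`. -/
def tmap (φ : E' → E) (p : E' × E') : E × E := (φ p.1, fderiv ℝ φ p.1 p.2)

variable {g : E → E →L[ℝ] E →L[ℝ] ℝ} {U : Set E} {V : Set E'} {φ : E' → E} {y : E'}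
  {f₁ f₂ : ℝ}

theorem fderiv_tmap_apply (hφ : IsImmersionOn φ V U) (hy : y ∈ V) (v : E') (X : E' × E') :
    fderiv ℝ (tmap φ) (y, v) X =
      (fderiv ℝ φ y X.1, fderiv ℝ (fderiv ℝ φ) y X.1 v + fderiv ℝ φ y X.2) := by
  have d1 := hφ.differentiableAt_of_contDiffOn hφ.contDiffOn hy
  have d2 := hφ.differentiableAt_of_contDiffOn hφ.contDiffOn_fderiv hy
  have hfst : DifferentiableAt ℝ (fun p : E' × E' => φ p.1) (y, v) :=
    DifferentiableAt.comp (y, v) d1 differentiableAt_fst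
  have hsnd : DifferentiableAt ℝ (fun p : E' × E' => fderiv ℝ φ p.1 p.2) (y, v) :=
    (DifferentiableAt.comp (y, v) d2 differentiableAt_fst).clm_apply differentiableAt_snd
  refine fderiv_eq_of_line (hfst.prodMk hsnd) EventuallyEq.rfl ?_
  have h := (hasDerivAt_line d1 X.1).prodMk
    ((hasDerivAt_line d2 X.1).clm_apply (hasDerivAt_add_smul v X.2))
  simpa [tmap] using h

theorem IsImmersionOn.tmap (hφ : IsImmersionOn φ V U) :
    IsImmersionOn (tmap φ) (V ×ˢ univ) (U ×ˢ univ) where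
  isOpen := hφ.isOpen.prod isOpen_univ
  contDiffOn := by
    have hfst : MapsTo (Prod.fst : E' × E' → E') (V ×ˢ univ) V := fun p hp => hp.1
    exact (hφ.contDiffOn.comp contDiff_fst.contDiffOn hfst).prodMk
      ((hφ.contDiffOn_fderiv.comp contDiff_fst.contDiffOn hfst).clm_apply contDiff_snd.contDiffOn)
  mapsTo p hp := ⟨hφ.mapsTo hp.1, trivial⟩
  injective p hp := by
    refine (injective_iff_map_eq_zero _).2 fun X hX => ?_
    have hinj := (injective_iff_map_eq_zero _).1 (hφ.injective p.1 hp.1)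
    have hX' : fderiv ℝ (RiemCurv.tmap φ) (p.1, p.2) X = 0 := hX
    rw [fderiv_tmap_apply hφ hp.1, Prod.mk_eq_zero] at hX'
    have h1 := hinj _ hX'.1
    simp only [h1, map_zero, zero_apply, zero_add, true_and] at hX'
    exact Prod.ext h1 (hinj _ hX')

theorem surjective_fderiv_tmap (hφ : IsImmersionOn φ V U) (hy : y ∈ V) (v : E')
    (hs : Function.Surjective (fderiv ℝ φ y)) :
    Function.Surjective (fderiv ℝ (tmap φ) (y, v)) := by
  rintro ⟨a, b⟩
  obtain ⟨a, rfl⟩ := hs a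
  obtain ⟨c, hc⟩ := hs (b - fderiv ℝ (fderiv ℝ φ) y a v)
  exact ⟨(a, c), by rw [fderiv_tmap_apply hφ hy, hc]; simp⟩

variable [FiniteDimensional ℝ E] [FiniteDimensional ℝ E']

/-- The connection maps are intertwined by the tangent map of an isometry. -/
theorem coordConn_fderiv_tmap (hφ : IsImmersionOn φ V U) (hg : IsMetricOn g U) (hy : y ∈ V)
    (hs : Function.Surjective (fderiv ℝ φ y)) (v : E') (X : E' × E') :
    coordConn g (tmap φ (y, v)) (fderiv ℝ (tmap φ) (y, v) X) =
      fderiv ℝ φ y (coordConn (pull g φ) (y, v) X) := by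
  have h := hφ.covHess_eq_of_surjective hg hy hs X.1 v
  rw [covHess] at h
  rw [fderiv_tmap_apply hφ hy, coordConn_apply, coordConn_apply, map_add, ← h]
  simp only [tmap]
  abel

/-- The tangent map of an isometry is an isometry of the Sasaki metrics. -/
theorem pull_coordSasaki_tmap (hφ : IsImmersionOn φ V U) (hg : IsMetricOn g U) (hy : y ∈ V)
    (hs : Function.Surjective (fderiv ℝ φ y)) (v : E') :
    pull (coordSasaki g f₁ f₂) (tmap φ) (y, v) = coordSasaki (pull g φ) f₁ f₂ (y, v) := by
  refine ContinuousLinearMap.ext fun X => ContinuousLinearMap.ext fun Y => ?_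
  have h := fun X => coordConn_fderiv_tmap hφ hg hy hs v X
  simp only [coordConn_apply] at h
  rw [pull_apply, coordSasaki_apply, coordSasaki_apply, h, h]
  simp [fderiv_tmap_apply hφ hy, tmap]

end TangentMaps

section Normal

variable {E : Type*} [NormedAddCommGroup E] [NormedSpace ℝ E]

/-- The map `y ↦ y - ½ Γ(y - x, y - x)`, to second order at `x` the inverse of a normal
coordinate chart when `Γ` are the Christoffel symbols at `x`. -/
def normalMap (Γ : E →L[ℝ] E →L[ℝ] E) (x y : E) : E := y - (1 / 2 : ℝ) • Γ (y - x) (y - x)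

theorem contDiff_normalMap (Γ : E →L[ℝ] E →L[ℝ] E) (x : E) : ContDiff ℝ ∞ (normalMap Γ x) := by
  unfold normalMap
  fun_prop

theorem fderiv_normalMap {Γ : E →L[ℝ] E →L[ℝ] E} (hΓ : ∀ a b, Γ a b = Γ b a) (x : E) :
    fderiv ℝ (normalMap Γ x) = fun y => ContinuousLinearMap.id ℝ E - Γ (y - x) := by
  funext y
  ext a
  refine fderiv_eq_of_line ((contDiff_normalMap Γ x).differentiable (by simp) y)
    EventuallyEq.rfl ?_
  have h1 := (hasDerivAt_add_smul y a).sub_const x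
  have h2 := (hasDerivAt_add_smul y a).sub
    ((((hasDerivAt_const (0 : ℝ) Γ).clm_apply h1).clm_apply h1).const_smul (1 / 2 : ℝ))
  convert h2 using 1
  · rfl
  · simp only [zero_smul, add_zero, zero_apply, zero_add, hΓ a (y - x), sub_apply,
      ContinuousLinearMap.id_apply]
    module

theorem snd_fderiv_normalMap {Γ : E →L[ℝ] E →L[ℝ] E} (hΓ : ∀ a b, Γ a b = Γ b a) (x y : E) :
    fderiv ℝ (fderiv ℝ (normalMap Γ x)) y = -Γ := by
  rw [fderiv_normalMap hΓ]
  simp only [map_sub]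
  rw [fderiv_const_sub, fderiv_sub_const, Γ.fderiv]

variable [FiniteDimensional ℝ E] {g : E → E →L[ℝ] E →L[ℝ] ℝ} {U : Set E} {x u : E} {f₁ f₂ : ℝ}

theorem exists_isImmersionOn_normalMap (hg : IsMetricOn g U) (hx : x ∈ U) :
    ∃ V, x ∈ V ∧ IsImmersionOn (normalMap (christoffel g x) x) V U := by
  have hc := contDiff_normalMap (christoffel g x) x
  have hc' : Continuous (fderiv ℝ (normalMap (christoffel g x) x)) :=
    hc.continuous_fderiv (by simp)
  refine ⟨normalMap (christoffel g x) x ⁻¹' U ∩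
    fderiv ℝ (normalMap (christoffel g x) x) ⁻¹' {L | Function.Injective L}, ⟨?_, ?_⟩,
    (hg.isOpen.preimage hc.continuous).inter
      (ContinuousLinearMap.isOpen_injective.preimage hc'), hc.contDiffOn,
    fun y hy => hy.1, fun y hy => hy.2⟩
  · simpa [normalMap] using hx
  · simp [fderiv_normalMap (hg.christoffel_symm x hx), Function.injective_id]

end Normal

section SasakiCurvature

variable {E : Type*} [NormedAddCommGroup E] [NormedSpace ℝ E] [FiniteDimensional ℝ E]
  {g : E → E →L[ℝ] E →L[ℝ] ℝ} {U : Set E} {x : E} {f₁ f₂ : ℝ}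

/-- The horizontal lift of `a` to the tangent vector `(x, u)`. -/
def horLift (g : E → E →L[ℝ] E →L[ℝ] ℝ) (x u a : E) : E × E := (a, -christoffel g x a u)

/-- Reduction to coordinates in which the Christoffel symbols vanish at `x`. The change of
coordinates fixes `x` and has derivative `1` there; its tangent map, an isometry of the Sasaki
metrics, has the derivative `(a, b) ↦ (a, b - Γ(a, u))` at `(x, u)`, which takes the splitting of
`E × E` to the splitting into horizontal and vertical vectors. -/
theorem exists_normal (hg : IsMetricOn g U) (h₁ : 0 < f₁) (h₂ : 0 < f₂) (hx : x ∈ U) (u : E) :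
    ∃ (g' : E → E →L[ℝ] E →L[ℝ] ℝ) (V : Set E), IsMetricOn g' V ∧ x ∈ V ∧ christoffel g' x = 0 ∧
      g' x = g x ∧ (∀ a b c, curv g' x a b c = curv g x a b c) ∧
      ∀ X Y : E × E,
        coordSasaki g f₁ f₂ (x, u)
          (curv (coordSasaki g f₁ f₂) (x, u) (horLift g x u X.1 + (0, X.2))
            (horLift g x u Y.1 + (0, Y.2)) (horLift g x u Y.1 + (0, Y.2)))
          (horLift g x u X.1 + (0, X.2)) =
        coordSasaki g' f₁ f₂ (x, u) (curv (coordSasaki g' f₁ f₂) (x, u) X Y Y) X := by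
  obtain ⟨V, hxV, hn⟩ := exists_isImmersionOn_normalMap hg hx
  have hΓ := hg.christoffel_symm x hx
  set n := normalMap (christoffel g x) x with hndef
  have hnx : n x = x := by simp [hndef, normalMap]
  have hdn : fderiv ℝ n x = ContinuousLinearMap.id ℝ E := by
    rw [hndef, fderiv_normalMap hΓ]; simp
  have hd2n : fderiv ℝ (fderiv ℝ n) x = -christoffel g x := snd_fderiv_normalMap hΓ x x
  have hs : Function.Surjective (fderiv ℝ n x) := by rw [hdn]; exact Function.surjective_id
  have hg' := hn.isMetricOn_pull hg
  have hxg : pull g n x = g x := by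
    ext a b; simp [hnx, hdn]
  refine ⟨pull g n, V, hg', hxV, ?_, hxg, fun a b c => ?_, fun X Y => ?_⟩
  · ext a b
    have h := hn.covHess_eq_of_surjective hg hxV hs a b
    rw [hdn, covHess, hd2n, hdn, hnx] at h
    simpa using h.symm
  · refine hg'.eq_of_forall hxV fun y => ?_
    rw [hn.apply_curv_pull_of_surjective hg hxV hs, hxg]
    simp [hnx, hdn]
  · have hS := hg.coordSasaki h₁ h₂
    have hz : (x, u) ∈ V ×ˢ (univ : Set E) := ⟨hxV, trivial⟩
    have hgerm : pull (coordSasaki g f₁ f₂) (tmap n) =ᶠ[𝓝 (x, u)]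
        coordSasaki (pull g n) f₁ f₂ := by
      have hev : ∀ᶠ y in 𝓝 x, y ∈ V := hn.mem_nhds hxV
      have hopen : ∀ᶠ p : E × E in 𝓝 (x, u), p.1 ∈ V := continuousAt_fst.eventually hev
      filter_upwards [hopen] with p hp
      have hsurj : Function.Surjective (fderiv ℝ n p.1) :=
        LinearMap.injective_iff_surjective (f := (fderiv ℝ n p.1 : E →ₗ[ℝ] E)).1
          (hn.injective p.1 hp)
      exact pull_coordSasaki_tmap hn hg hp hsurj p.2
    have hT : ∀ X, fderiv ℝ (tmap n) (x, u) X = horLift g x u X.1 + (0, X.2) := by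
      intro X
      rw [fderiv_tmap_apply hn hxV, hdn, hd2n]
      simp [horLift]
    have hTx : tmap n (x, u) = (x, u) := by simp [tmap, hnx, hdn]
    have h := hn.tmap.apply_curv_pull_of_surjective hS hz
      (surjective_fderiv_tmap hn hxV u hs) X Y Y X
    rw [hT, hT, hTx, curv_congr hgerm, hgerm.eq_of_nhds] at h
    exact h.symm

/-- O'Neill's formula for the sectional curvatures of horizontal planes. -/
theorem curv_coordSasaki_horizontal (hg : IsMetricOn g U) (h₁ : 0 < f₁) (h₂ : 0 < f₂)
    (hx : x ∈ U) (u a b : E) :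
    coordSasaki g f₁ f₂ (x, u) (curv (coordSasaki g f₁ f₂) (x, u) (horLift g x u a)
        (horLift g x u b) (horLift g x u b)) (horLift g x u a) =
      f₁ * g x (curv g x a b b) a
        - 3 / 4 * f₂ * g x (curv g x a b u) (curv g x a b u) := by
  obtain ⟨g', V, hg', hxV, h0, hgx, hR, h⟩ := exists_normal hg h₁ h₂ hx u
  have h' := h (a, 0) (b, 0)
  rw [curv_coordSasaki_horizontal_aux hg' h₁ h₂ hxV h0, hgx, hR, hR] at h'
  simpa only [Prod.mk_zero_zero, add_zero] using h'

theorem curv_coordSasaki_mixed (hg : IsMetricOn g U) (h₁ : 0 < f₁) (h₂ : 0 < f₂)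
    (hx : x ∈ U) (u a b : E) :
    0 ≤ coordSasaki g f₁ f₂ (x, u) (curv (coordSasaki g f₁ f₂) (x, u) (horLift g x u a)
        (0, b) (0, b)) (horLift g x u a) := by
  obtain ⟨g', V, hg', hxV, h0, hgx, hR, h⟩ := exists_normal hg h₁ h₂ hx u
  have h' := h (a, 0) (0, b)
  have h'' := curv_coordSasaki_mixed_aux hg' h₁ h₂ hxV h0 u a b
  rw [← h'] at h''
  simpa [horLift] using h''

theorem curv_coordSasaki_vertical (hg : IsMetricOn g U) (h₁ : 0 < f₁) (h₂ : 0 < f₂)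
    (hx : x ∈ U) (u b b' : E) :
    coordSasaki g f₁ f₂ (x, u) (curv (coordSasaki g f₁ f₂) (x, u) (0, b)
        (0, b') (0, b')) (0, b) = 0 := by
  obtain ⟨g', V, hg', hxV, h0, hgx, hR, h⟩ := exists_normal hg h₁ h₂ hx u
  have h' := h (0, b) (0, b')
  rw [curv_coordSasaki_vertical_aux hg' h₁ h₂ hxV h0] at h'
  simpa [horLift] using h'

theorem curv_coordSasaki_liouville_self (hg : IsMetricOn g U) (h₁ : 0 < f₁) (h₂ : 0 < f₂)
    (hx : x ∈ U) (u : E) (X : E × E) :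
    coordSasaki g f₁ f₂ (x, u) (curv (coordSasaki g f₁ f₂) (x, u) X (0, u) (0, u)) X = 0 := by
  obtain ⟨g', V, hg', hxV, h0, hgx, hR, h⟩ := exists_normal hg h₁ h₂ hx u
  have h' := h (X.1, X.2 + christoffel g x X.1 u) (0, u)
  rw [curv_coordSasaki_liouville_aux hg' h₁ h₂ hxV h0] at h'
  simpa [horLift] using h'

/-- The curvature operator `R(·, N) N` of the Sasaki metric vanishes, for the Liouville field
`N = (0, u)`. -/
theorem curv_coordSasaki_liouville (hg : IsMetricOn g U) (h₁ : 0 < f₁) (h₂ : 0 < f₂)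
    (hx : x ∈ U) (u : E) (X Y : E × E) :
    coordSasaki g f₁ f₂ (x, u) (curv (coordSasaki g f₁ f₂) (x, u) X (0, u) (0, u)) Y = 0 := by
  have hS := hg.coordSasaki h₁ h₂
  have hz : (x, u) ∈ U ×ˢ (univ : Set E) := ⟨hx, trivial⟩
  have hXY := curv_coordSasaki_liouville_self hg h₁ h₂ hx u (X + Y)
  have hX := curv_coordSasaki_liouville_self hg h₁ h₂ hx u X
  have hY := curv_coordSasaki_liouville_self hg h₁ h₂ hx u Y
  have hsym := hS.apply_curv_pair_symm hz X (0, u) (0, u) Y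
  have hadd : curv (RiemCurv.coordSasaki g f₁ f₂) (x, u) (X + Y) (0, u) (0, u) =
      curv (RiemCurv.coordSasaki g f₁ f₂) (x, u) X (0, u) (0, u) +
      curv (RiemCurv.coordSasaki g f₁ f₂) (x, u) Y (0, u) (0, u) :=
    map_add (curvLin (RiemCurv.coordSasaki g f₁ f₂) (x, u) (0, u) (0, u)) X Y
  rw [IsMetricOn.curv_antisymm _ _ (0, u), map_neg, neg_apply,
    hS.apply_curv_antisymm hz Y, neg_neg] at hsym
  rw [hadd] at hXY
  simp only [map_add, add_apply] at hXY
  linarith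

end SasakiCurvature

/-! ### Hypersurfaces orthogonal to the Liouville field -/

section Bases

variable {F : Type*} [NormedAddCommGroup F] [NormedSpace ℝ F] {ι : Type*} [Fintype ι]
  [DecidableEq ι] {B : F →L[ℝ] F →L[ℝ] ℝ}

theorem OrthonormalFor.parseval {e : Module.Basis ι ℝ F} (he : OrthonormalFor B e) (v w : F) :
    B v w = ∑ i, B v (e i) * B w (e i) := by
  conv_lhs => rw [he.eq_sum v]
  simp [map_sum, sum_apply, he.symm]

theorem OrthonormalFor.exists_basis [FiniteDimensional ℝ F] {e : ι → F} (he : OrthonormalFor B e)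
    (hcard : Fintype.card ι = Module.finrank ℝ F) :
    ∃ b : Module.Basis ι ℝ F, ⇑b = e := by
  refine ⟨Module.Basis.mk he.linearIndependent ?_, Module.Basis.coe_mk _ _⟩
  rw [he.linearIndependent.span_eq_top_of_card_eq_finrank' hcard]

end Bases

section Frames

variable {E : Type*} [NormedAddCommGroup E] [NormedSpace ℝ E]

/-- The vertical part `f₂ π^*g` of the Sasaki metric, as a form on all tangent vectors. -/
def vertForm (g : E → E →L[ℝ] E →L[ℝ] ℝ) (f₂ : ℝ) (p X Y : E × E) : ℝ :=
  f₂ * g p.1 (coordConn g p X) (coordConn g p Y)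

theorem vertForm_eq (g : E → E →L[ℝ] E →L[ℝ] ℝ) (x : E) (f₁ f₂ : ℝ) (u : E)
    (X Y : E × E) :
    vertForm g f₂ (x, u) X Y = coordSasaki g f₁ f₂ (x, u) (0, coordConn g (x, u) X) Y := by
  simp [vertForm, coordSasaki_apply, coordConn_apply]

variable [FiniteDimensional ℝ E] {g : E → E →L[ℝ] E →L[ℝ] ℝ} {U : Set E} {x : E} {f₁ f₂ : ℝ}

/-- An orthonormal basis of the Sasaki metric adapted to the splitting into horizontal and vertical
vectors. -/
theorem exists_adapted_basis (hg : IsMetricOn g U) (h₁ : 0 < f₁) (h₂ : 0 < f₂) (hx : x ∈ U)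
    (u : E) :
    ∃ (ε δ : Module.Basis (Fin (Module.finrank ℝ E)) ℝ E)
      (b : Module.Basis (Fin (Module.finrank ℝ E) ⊕ Fin (Module.finrank ℝ E)) ℝ (E × E)),
      OrthonormalFor (f₁ • g x) ε ∧ OrthonormalFor (f₂ • g x) δ ∧
      OrthonormalFor (coordSasaki g f₁ f₂ (x, u)) b ∧
      (∀ i, b (Sum.inl i) = horLift g x u (ε i)) ∧ ∀ i, b (Sum.inr i) = (0, δ i) := by
  have hex : ∀ f : ℝ, 0 < f → ∃ e : Module.Basis (Fin (Module.finrank ℝ E)) ℝ E,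
      OrthonormalFor (f • g x) e := fun f hf => by
    refine exists_orthonormalFor (fun v w => ?_) fun v hv => ?_
    · simp [hg.symm x hx v w]
    · simpa using mul_pos hf (hg.pos x hx v hv)
  obtain ⟨ε, hε⟩ := hex f₁ h₁
  obtain ⟨δ, hδ⟩ := hex f₂ h₂
  have ho : OrthonormalFor (coordSasaki g f₁ f₂ (x, u))
      (Sum.elim (fun i => horLift g x u (ε i)) (fun i => ((0, δ i) : E × E))) := by
    rintro (i | i) (j | j)
    · simpa [coordSasaki_apply, horLift] using hε i j
    · simp [coordSasaki_apply, horLift]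
    · simp [coordSasaki_apply, horLift]
    · simpa [coordSasaki_apply, horLift] using hδ i j
  obtain ⟨b, hb⟩ := ho.exists_basis (by simp)
  rw [← hb] at ho
  exact ⟨ε, δ, b, hε, hδ, ho, fun i => by rw [hb]; rfl, fun i => by rw [hb]; rfl⟩

/-- The vertical part has trace `dim E` in every orthonormal basis. -/
theorem sum_vertForm (hg : IsMetricOn g U) (h₁ : 0 < f₁) (h₂ : 0 < f₂) (hx : x ∈ U) (u : E)
    {κ : Type*} [Fintype κ] [DecidableEq κ] {f : Module.Basis κ ℝ (E × E)}
    (hf : OrthonormalFor (coordSasaki g f₁ f₂ (x, u)) f) :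
    ∑ i, vertForm g f₂ (x, u) (f i) (f i) = Module.finrank ℝ E := by
  obtain ⟨ε, δ, b, hε, hδ, hb, hbl, hbr⟩ := exists_adapted_basis hg h₁ h₂ hx u
  rw [hf.sum_eq_sum hb (vertForm g f₂ (x, u)) (by simp [vertForm, mul_add])
    (by simp [vertForm, mul_left_comm]) (by simp [vertForm, mul_add])
    (by simp [vertForm, mul_left_comm])]
  have h : ∀ i, f₂ * g x (δ i) (δ i) = 1 := fun i => by simpa using hδ i i
  simp [Fintype.sum_sum_type, hbl, hbr, vertForm, coordConn_apply, horLift, h]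

/-- The Christoffel term of the covariant derivative of the Liouville field `N = (0, u)`. Added to
the derivative `(0, X.2)` of `N`, it shows that `∇_X N` is the vertical part of `X`. -/
theorem christoffel_liouville (hg : IsMetricOn g U) (h₁ : 0 < f₁) (h₂ : 0 < f₂)
    (hx : x ∈ U) (u : E) (X : E × E) :
    christoffel (coordSasaki g f₁ f₂) (x, u) X (0, u) = (0, christoffel g x X.1 u) := by
  have hS := hg.coordSasaki h₁ h₂
  have hz : (x, u) ∈ U ×ˢ (univ : Set E) := ⟨hx, trivial⟩
  refine hS.eq_of_forall hz fun Y => ?_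
  rw [hS.apply_christoffel hz, koszul_apply]
  simp only [fderiv_coordSasaki hg h₁ h₂ hx, coordSasaki_apply]
  -- the terms with derivatives of the Christoffel symbols add up to `g (R(a, a') u, u) = 0`
  have hR : g x (curv g x X.1 Y.1 u) u = 0 := by
    have := hg.apply_curv_antisymm hx X.1 Y.1 u u
    linarith
  simp only [curv, map_add, map_sub, add_apply, sub_apply] at hR
  simp only [hg.fderiv_eq_christoffel hx, map_zero, zero_apply, add_zero, mul_zero, zero_add,
    map_add, add_apply, hg.symm x hx u]
  linear_combination (f₂ / 2) * hR

end Frames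

section Hypersurface

variable {E : Type*} [NormedAddCommGroup E] [NormedSpace ℝ E] [FiniteDimensional ℝ E]
  {F' : Type*} [NormedAddCommGroup F'] [NormedSpace ℝ F']
  {g : E → E →L[ℝ] E →L[ℝ] ℝ} {U : Set E} {V : Set F'} {φ : F' → E × E} {z : F'}
  {f₁ f₂ r : ℝ}

/-- An immersion into the set of tangent vectors of constant length is orthogonal to the Liouville
field. -/
theorem liouville_orthogonal (hg : IsMetricOn g U)
    (hφ : IsImmersionOn φ V (U ×ˢ univ)) (hr : ∀ z ∈ V, g (φ z).1 (φ z).2 (φ z).2 = r ^ 2)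
    (hz : z ∈ V) (v : F') :
    coordSasaki g f₁ f₂ (φ z) (fderiv ℝ φ z v) (0, (φ z).2) = 0 := by
  have hx : (φ z).1 ∈ U := (hφ.mapsTo hz).1
  have d1 := hφ.differentiableAt_of_contDiffOn hφ.contDiffOn hz
  have hl := hasDerivAt_line d1 v
  have hl1 : HasDerivAt (fun t : ℝ => (φ (z + t • v)).1) (fderiv ℝ φ z v).1 0 :=
    (ContinuousLinearMap.fst ℝ E E).hasFDerivAt.comp_hasDerivAt (0 : ℝ) hl
  have hl2 : HasDerivAt (fun t : ℝ => (φ (z + t • v)).2) (fderiv ℝ φ z v).2 0 :=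
    (ContinuousLinearMap.snd ℝ E E).hasFDerivAt.comp_hasDerivAt (0 : ℝ) hl
  have hg' : HasFDerivAt g (fderiv ℝ g (φ z).1) (φ (z + (0 : ℝ) • v)).1 := by
    simpa using (hg.differentiableAt hx).hasFDerivAt
  have hG := hg'.comp_hasDerivAt (0 : ℝ) hl1
  have h := (hG.clm_apply hl2).clm_apply hl2
  have h0 := h.unique ((hasDerivAt_const (0 : ℝ) (r ^ 2)).congr_of_eventuallyEq (by
    filter_upwards [(tendsto_line z v).eventually (hφ.mem_nhds hz)] with t ht
    exact hr _ ht))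
  simp only [Function.comp_apply, zero_smul, add_zero, add_apply,
    hg.fderiv_eq_christoffel hx] at h0
  simp only [coordSasaki_apply, map_zero, mul_zero, zero_add, zero_apply, add_zero, map_add,
    add_apply]
  rw [hg.symm _ hx (φ z).2, hg.symm _ hx (φ z).2] at h0
  linear_combination (f₂ / 2) * h0

/-- The second fundamental form of such an immersion, with respect to the normal `N = (0, u)` (of
square length `f₂ r²`), is minus the vertical part of the metric: differentiate the orthogonality
of `dφ w` and `N`. -/
theorem covHess_liouville (hg : IsMetricOn g U) (h₁ : 0 < f₁) (h₂ : 0 < f₂)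
    (hφ : IsImmersionOn φ V (U ×ˢ univ)) (hr : ∀ z ∈ V, g (φ z).1 (φ z).2 (φ z).2 = r ^ 2)
    (hz : z ∈ V) (v w : F') :
    coordSasaki g f₁ f₂ (φ z) (covHess (coordSasaki g f₁ f₂) φ z v w) (0, (φ z).2) =
      -vertForm g f₂ (φ z) (fderiv ℝ φ z v) (fderiv ℝ φ z w) := by
  have hS := hg.coordSasaki h₁ h₂
  have hzU := hφ.mapsTo hz
  have hx : (φ z).1 ∈ U := hzU.1
  have d1 := hφ.differentiableAt_of_contDiffOn hφ.contDiffOn hz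
  have d2 := hφ.differentiableAt_of_contDiffOn hφ.contDiffOn_fderiv hz
  have hl := hasDerivAt_line d1 v
  have hl2 : HasDerivAt (fun t : ℝ => (φ (z + t • v)).2) (fderiv ℝ φ z v).2 0 :=
    (ContinuousLinearMap.snd ℝ E E).hasFDerivAt.comp_hasDerivAt (0 : ℝ) hl
  have hN : HasDerivAt (fun t : ℝ => ((0, (φ (z + t • v)).2) : E × E)) (0, (fderiv ℝ φ z v).2) 0 :=
    (hasDerivAt_const (0 : ℝ) (0 : E)).prodMk hl2
  have h := ((hasDerivAt_comp_line (hS.differentiableAt hzU) d1 v).clm_apply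
    ((hasDerivAt_line d2 v).clm_apply (hasDerivAt_const 0 w))).clm_apply hN
  have h0 := h.unique ((hasDerivAt_const (0 : ℝ) (0 : ℝ)).congr_of_eventuallyEq (by
    filter_upwards [(tendsto_line z v).eventually (hφ.mem_nhds hz)] with t ht
    exact liouville_orthogonal hg hφ hr ht w))
  have hc : christoffel (coordSasaki g f₁ f₂) (φ z) (fderiv ℝ φ z v) (0, (φ z).2) = _ :=
    christoffel_liouville hg h₁ h₂ hx (φ z).2 (fderiv ℝ φ z v)
  simp only [zero_smul, add_zero, add_apply, map_zero, hS.fderiv_eq_christoffel hzU, hc] at h0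
  rw [covHess, map_add, add_apply]
  have hv : vertForm g f₂ (φ z) (fderiv ℝ φ z v) (fderiv ℝ φ z w) =
      coordSasaki g f₁ f₂ (φ z) (fderiv ℝ φ z w) (0, (fderiv ℝ φ z v).2) +
      coordSasaki g f₁ f₂ (φ z) (fderiv ℝ φ z w)
        (0, christoffel g (φ z).1 (fderiv ℝ φ z v).1 (φ z).2) := by
    rw [← map_add, Prod.mk_add_mk, add_zero, ← coordConn_apply,
      hS.symm _ hzU (fderiv ℝ φ z w)]
    exact vertForm_eq g _ f₁ f₂ (φ z).2 _ _
  rw [hv]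
  linarith

variable [FiniteDimensional ℝ F']

/-- The Ricci and scalar curvatures of an immersed hypersurface in the bundle of tangent vectors of
length `r`: the Gauss equation for a hypersurface whose second fundamental form is the vertical
part of the metric and whose normal curvature operator `R(·, N) N` vanishes. The vertical form has
trace `dim E - 1` on the hypersurface, and acts there as a projection. -/
theorem ric_scal_hypersurface (hg : IsMetricOn g U) (h₁ : 0 < f₁) (h₂ : 0 < f₂) (hr0 : 0 < r)
    (hφ : IsImmersionOn φ V (U ×ˢ univ)) (hr : ∀ z ∈ V, g (φ z).1 (φ z).2 (φ z).2 = r ^ 2)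
    (hdim : Module.finrank ℝ F' + 1 = 2 * Module.finrank ℝ E) (hz : z ∈ V) :
    (∀ v w, ric (pull (coordSasaki g f₁ f₂) φ) z v w =
      ric (coordSasaki g f₁ f₂) (φ z) (fderiv ℝ φ z v) (fderiv ℝ φ z w) +
        (Module.finrank ℝ E - 2) / (f₂ * r ^ 2) *
          vertForm g f₂ (φ z) (fderiv ℝ φ z v) (fderiv ℝ φ z w)) ∧
    scal (pull (coordSasaki g f₁ f₂) φ) z = scal (coordSasaki g f₁ f₂) (φ z) +
      (Module.finrank ℝ E - 1) * (Module.finrank ℝ E - 2) / (f₂ * r ^ 2) := by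
  have hS := hg.coordSasaki h₁ h₂
  have hzU := hφ.mapsTo hz
  have hP := hφ.isMetricOn_pull hS
  set G := coordSasaki g f₁ f₂ with hGdef
  set D := fderiv ℝ φ z with hD
  set N : E × E := (0, (φ z).2) with hNdef
  set ν : ℝ := f₂ * r ^ 2 with hν
  set β := vertForm g f₂ (φ z) with hβ
  have hν0 : 0 < ν := by positivity
  have hx : (φ z).1 ∈ U := hzU.1
  have horth : ∀ v, G (φ z) (D v) N = 0 := liouville_orthogonal hg hφ hr hz
  have horth' : ∀ v, G (φ z) N (D v) = 0 := fun v => by rw [hS.symm _ hzU, horth]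
  have hNN : G (φ z) N N = ν := by
    simp [hGdef, hNdef, coordSasaki_apply, hr z hz, hν]
  obtain ⟨e, he⟩ := exists_orthonormalFor (B := pull G φ z) (hP.symm z hz) (hP.pos z hz)
  -- the frame of the hypersurface, completed by the unit normal
  set s : ℝ := (Real.sqrt ν)⁻¹ with hs
  have hss : s * s = ν⁻¹ := by
    rw [hs, ← mul_inv, Real.mul_self_sqrt hν0.le]
  have ho : OrthonormalFor (G (φ z))
      (fun k : Option (Fin (Module.finrank ℝ F')) => k.elim (s • N) fun i => D (e i)) := by
    rintro (_ | i) (_ | j)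
    · have : s * (s * ν) = 1 := by rw [← mul_assoc, hss, inv_mul_cancel₀ hν0.ne']
      simpa [hNN] using this
    · simp [horth']
    · simp [horth]
    · simpa using he i j
  obtain ⟨f, hf⟩ := ho.exists_basis (by simp [hdim, two_mul])
  rw [← hf] at ho
  have hfs : ∀ i, f (some i) = D (e i) := fun i => by rw [hf]; rfl
  have hfn : f none = s • N := by rw [hf]; rfl
  have hβG : ∀ X Y, β X Y = G (φ z) (0, coordConn g (φ z) X) Y := fun X Y =>
    vertForm_eq g _ f₁ f₂ (φ z).2 X Y
  have hβs : ∀ X Y, β X Y = β Y X := fun X Y => by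
    simp only [hβ, vertForm]; rw [hg.symm _ hx]
  have hβN : ∀ X, β N X = G (φ z) N X := fun X => by
    rw [hβG]; simp [coordConn_apply, hNdef]
  have hβD : ∀ v, β N (D v) = 0 := fun v => by rw [hβN, horth']
  have hβss : β (s • N) (s • N) = 1 := by
    have h1 : β (s • N) (s • N) = s * s * β N N := by simp [hβ, vertForm]; ring
    rw [h1, hβN, hNN, hss, inv_mul_cancel₀ hν0.ne']
  have htr : ∑ i, β (D (e i)) (D (e i)) = Module.finrank ℝ E - 1 := by
    have h := sum_vertForm hg h₁ h₂ hx (φ z).2 ho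
    rw [Fintype.sum_option, hfn] at h
    simp only [hfs] at h
    change β _ _ + ∑ i, β _ _ = _ at h
    rw [hβss] at h
    linarith
  have hproj : ∀ v w, ∑ i, β (D (e i)) (D w) * β (D v) (D (e i)) = β (D v) (D w) := by
    intro v w
    have h := ho.parseval (0, coordConn g (φ z) (D v)) (0, coordConn g (φ z) (D w))
    rw [Fintype.sum_option, hfn] at h
    simp only [hfs, ← hβG] at h
    have h1 : β (D v) (s • N) = 0 := by
      have : β (D v) (s • N) = s * β N (D v) := by
        rw [hβs (D v)]; simp [hβ, vertForm]; ring
      rw [this, hβD, mul_zero]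
    have h2 : β (D v) (0, coordConn g (φ z) (D w)) = β (D v) (D w) := by
      simp [hβ, vertForm, coordConn_apply]
    rw [h1, h2, zero_mul, zero_add] at h
    rw [h]
    exact Finset.sum_congr rfl fun i _ => by rw [hβs (D (e i))]; ring
  have hgauss : ∀ x y w v, pull G φ z (curv (pull G φ) z x y w) v =
      G (φ z) (curv G (φ z) (D x) (D y) (D w)) (D v) +
        ν⁻¹ * (β (D y) (D w) * β (D x) (D v) - β (D x) (D w) * β (D y) (D v)) := by
    intro x y w v
    have key : ∀ a b c d, G (φ z) (covHess G φ z a b) (covHess G φ z c d) -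
        pull G φ z (christoffel (pull G φ) z a b) (christoffel (pull G φ) z c d) =
        ν⁻¹ * (β (D a) (D b) * β (D c) (D d)) := by
      intro a b c d
      rw [ho.parseval, he.parseval, Fintype.sum_option, hfn]
      simp only [hfs, hP.apply_christoffel hz, hφ.koszul_pull hS hz, map_smul, smul_eq_mul]
      have hcov := covHess_liouville hg h₁ h₂ hφ hr hz
      rw [← hGdef] at hcov
      rw [hcov, hcov, ← hss]
      ring
    rw [hφ.apply_curv_pull hS hz]
    have k1 := key y w x v
    have k2 := key x w y v
    rw [hP.symm z hz (christoffel (pull G φ) z x v), hP.symm z hz (christoffel (pull G φ) z y v)]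
    linarith
  have hRN : ∀ X Y, G (φ z) (curv G (φ z) X N N) Y = 0 :=
    curv_coordSasaki_liouville hg h₁ h₂ hx (φ z).2
  have hRN' : ∀ X Y, G (φ z) (curv G (φ z) (s • N) X Y) (s • N) = 0 := by
    intro X Y
    have h1 : curv G (φ z) (s • N) X Y = s • curv G (φ z) N X Y :=
      map_smul (curvLin G (φ z) X Y) s N
    have h2 := hS.apply_curv_pair_symm hzU N X Y N
    rw [hRN] at h2
    simp [h1, h2]
  have hric : ∀ v w, ric (pull G φ) z v w = ric G (φ z) (D v) (D w) +
      (Module.finrank ℝ E - 2) / ν * β (D v) (D w) := by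
    intro v w
    rw [ric_eq_sum he, ric_eq_sum ho, Fintype.sum_option, hfn, hRN', zero_add]
    simp only [hfs, hgauss, Finset.sum_add_distrib, ← Finset.mul_sum, Finset.sum_sub_distrib,
      htr, hproj]
    field_simp
    ring
  refine ⟨hric, ?_⟩
  rw [scal_eq_sum_ric hP hz he, scal_eq_sum_ric hS hzU ho, Fintype.sum_option, hfn]
  have hNric : ric G (φ z) (s • N) (s • N) = 0 := by
    rw [ric_eq_sum ho]
    refine Finset.sum_eq_zero fun i _ => ?_
    rw [hS.apply_curv_pair_symm hzU]
    exact hRN' _ _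
  simp only [hric, hfs, hNric, zero_add, Finset.sum_add_distrib, ← Finset.mul_sum, htr]
  ring

end Hypersurface

/-! ### Bounds on the curvature -/

section Bounds

variable {E : Type*} [NormedAddCommGroup E] [NormedSpace ℝ E]

/-- On dependent pairs, where sectional curvatures are not defined, the curvature form vanishes. -/
theorem curv_eq_zero_of_not_linearIndependent (g : E → E →L[ℝ] E →L[ℝ] ℝ) (x a b : E)
    (h : ¬ LinearIndependent ℝ ![a, b]) : curv g x a b b = 0 := by
  have hz : ∀ c d, curv g x c c d = 0 := fun c d => by simp [curv]
  rw [LinearIndependent.pair_iff] at h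
  push Not at h
  obtain ⟨s, t, hst, hne⟩ := h
  have e1 : curv g x (s • a + t • b) b b = s • curv g x a b b + t • curv g x b b b := by
    have := map_add (curvLin g x b b) (s • a) (t • b)
    rw [map_smul, map_smul] at this
    exact this
  rw [hst, hz, smul_zero, add_zero] at e1
  have e0 : curv g x 0 b b = 0 := map_zero (curvLin g x b b)
  rw [e0] at e1
  rcases eq_or_ne s 0 with hs | hs
  · have ht := hne hs
    have hb : b = 0 := by simpa [hs, ht] using hst
    simp [hb, curv]
  · exact (smul_eq_zero.1 e1.symm).resolve_left hs

variable [FiniteDimensional ℝ E] {g : E → E →L[ℝ] E →L[ℝ] ℝ} {U : Set E} {x : E} {f₁ f₂ C : ℝ}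

/-- A bound on the sectional curvatures bounds the curvature tensor on vectors of length at most
one: polarize in both pairs of arguments and use the Bianchi identity. -/
theorem abs_curv_le_of_le_one (hg : IsMetricOn g U) (hx : x ∈ U) (hC0 : 0 ≤ C)
    (hC : ∀ a b, |g x (curv g x a b b) a| ≤ C * (g x a a * g x b b)) {a b c d : E}
    (ha : g x a a ≤ 1) (hb : g x b b ≤ 1) (hc : g x c c ≤ 1) (hd : g x d d ≤ 1) :
    |g x (curv g x a b c) d| ≤ 2 * C := by
  set R : E → E → E → E → ℝ := fun a b c d => g x (curv g x a b c) d with hR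
  have hpair : ∀ a b c d, R a b c d = R c d a b := hg.apply_curv_pair_symm hx
  have hanti : ∀ a b c d, R a b c d = -R b a c d := fun a b c d => by
    simp only [hR]; rw [IsMetricOn.curv_antisymm]; simp
  have hanti' : ∀ a b c d, R a b c d = -R a b d c := hg.apply_curv_antisymm hx
  have hbianchi : ∀ a b c d, R a b c d + R b c a d + R c a b d = 0 := hg.bianchi hx
  have add1 : ∀ a a' b c d, R (a + a') b c d = R a b c d + R a' b c d := fun a a' b c d => by
    simp only [hR]
    rw [show curv g x (a + a') b c = curv g x a b c + curv g x a' b c from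
      map_add (curvLin g x b c) a a', map_add, add_apply]
  have sub1 : ∀ a a' b c d, R (a - a') b c d = R a b c d - R a' b c d := fun a a' b c d => by
    have := add1 (a - a') a' b c d
    rw [sub_add_cancel] at this; linarith
  have add4 : ∀ a b c d d', R a b c (d + d') = R a b c d + R a b c d' := by simp [hR]
  have sub4 : ∀ a b c d d', R a b c (d - d') = R a b c d - R a b c d' := by simp [hR]
  have add2 : ∀ a b b' c d, R a (b + b') c d = R a b c d + R a b' c d := fun a b b' c d => by
    rw [hanti a (b + b'), add1, hanti b, hanti b']; ring
  have sub2 : ∀ a b b' c d, R a (b - b') c d = R a b c d - R a b' c d := fun a b b' c d => by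
    rw [hanti a (b - b'), sub1, hanti b, hanti b']; ring
  have add3 : ∀ a b c c' d, R a b (c + c') d = R a b c d + R a b c' d := fun a b c c' d => by
    rw [hanti' a b (c + c'), add4, hanti' a b d, hanti' a b d]; ring
  have sub3 : ∀ a b c c' d, R a b (c - c') d = R a b c d - R a b c' d := fun a b c c' d => by
    rw [hanti' a b (c - c'), sub4, hanti' a b d, hanti' a b d]; ring
  have hpar : ∀ v w, g x (v + w) (v + w) + g x (v - w) (v - w) =
      2 * (g x v v + g x w w) := fun v w => by
    simp only [map_add, map_sub, add_apply, sub_apply]; ring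
  have step1 : ∀ a b d, |R a b b d| ≤ C / 2 * (g x b b * (g x a a + g x d d)) := by
    intro a b d
    have h1 := abs_le.1 (hC (a + d) b)
    have h2 := abs_le.1 (hC (a - d) b)
    change -_ ≤ R (a + d) b b (a + d) ∧ R (a + d) b b (a + d) ≤ _ at h1
    change -_ ≤ R (a - d) b b (a - d) ∧ R (a - d) b b (a - d) ≤ _ at h2
    have h3 : R d b b a = R a b b d := by
      rw [hpair, hanti, hanti', neg_neg]
    rw [add1, add4, add4, h3] at h1
    rw [sub1, sub4, sub4, h3] at h2
    have h4 := congrArg (fun t => C * (t * g x b b)) (hpar a d)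
    rw [abs_le]
    constructor <;> linarith [h1.1, h1.2, h2.1, h2.2]
  have step2 : ∀ a b c d, g x a a ≤ 1 → g x b b ≤ 1 → g x c c ≤ 1 → g x d d ≤ 1 →
      |R a b c d + R a c b d| ≤ 2 * C := by
    intro a b c d ha hb hc hd
    have h1 := abs_le.1 (step1 a (b + c) d)
    have h2 := abs_le.1 (step1 a (b - c) d)
    rw [add2, add3, add3] at h1
    rw [sub2, sub3, sub3] at h2
    have h4 := congrArg (fun t => C / 2 * (t * (g x a a + g x d d))) (hpar b c)
    have h5 : (g x b b + g x c c) * (g x a a + g x d d) ≤ 2 * 2 :=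
      mul_le_mul (by linarith) (by linarith)
        (add_nonneg (hg.nonneg hx _) (hg.nonneg hx _)) (by norm_num)
    have h6 := mul_le_mul_of_nonneg_left h5 hC0
    rw [abs_le]
    constructor <;> linarith [h1.1, h1.2, h2.1, h2.2]
  have h1 := abs_le.1 (step2 a b c d ha hb hc hd)
  have h2 := abs_le.1 (step2 b a c d hb ha hc hd)
  have h3 := hbianchi a b c d
  have h4 := hanti b a c d
  have h5 := hanti c a b d
  change |R a b c d| ≤ 2 * C
  rw [abs_le]
  constructor <;> linarith [h1.1, h1.2, h2.1, h2.2]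

/-- A bound on the sectional curvatures bounds the curvature tensor. -/
theorem sq_curv_le (hg : IsMetricOn g U) (hx : x ∈ U) (hC0 : 0 ≤ C)
    (hC : ∀ a b, |g x (curv g x a b b) a| ≤ C * (g x a a * g x b b)) (a b c d : E) :
    g x (curv g x a b c) d ^ 2 ≤
      (2 * C) ^ 2 * (g x a a * g x b b * g x c c * g x d d) := by
  -- normalize the four vectors
  have hn : ∀ v : E, ∃ (s : ℝ) (w : E), v = s • w ∧ g x w w ≤ 1 ∧ s ^ 2 = g x v v := by
    intro v
    rcases eq_or_ne v 0 with rfl | hv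
    · exact ⟨0, 0, by simp, by simp, by simp⟩
    · have hp := hg.pos x hx v hv
      have hs := Real.sqrt_pos.2 hp
      refine ⟨Real.sqrt (g x v v), (Real.sqrt (g x v v))⁻¹ • v, ?_, ?_, Real.sq_sqrt hp.le⟩
      · rw [smul_smul, mul_inv_cancel₀ hs.ne', one_smul]
      · simp only [map_smul, smul_apply, smul_eq_mul]
        rw [← mul_assoc, ← mul_inv, Real.mul_self_sqrt hp.le, inv_mul_cancel₀ hp.ne']
  obtain ⟨sa, a', ha, ha1, hsa⟩ := hn a
  obtain ⟨sb, b', hb, hb1, hsb⟩ := hn b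
  obtain ⟨sc, c', hc, hc1, hsc⟩ := hn c
  obtain ⟨sd, d', hd, hd1, hsd⟩ := hn d
  have h := abs_curv_le_of_le_one hg hx hC0 hC ha1 hb1 hc1 hd1
  have h' := sq_le_sq' (abs_le.1 h).1 (abs_le.1 h).2
  rw [← hsa, ← hsb, ← hsc, ← hsd, ha, hb, hc, hd]
  have e : g x (curv g x (sa • a') (sb • b') (sc • c')) (sd • d') =
      sa * sb * sc * sd * g x (curv g x a' b' c') d' := by
    simp only [curv, map_smul, smul_apply, map_sub, map_add, sub_apply, add_apply, smul_eq_mul]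
    ring
  rw [e, mul_pow, mul_comm]
  calc _ ≤ (2 * C) ^ 2 * (sa * sb * sc * sd) ^ 2 := mul_le_mul_of_nonneg_right h' (sq_nonneg _)
    _ = _ := by ring

/-- A lower bound for the scalar curvature of the Sasaki metric. In an adapted orthonormal basis,
vertical planes are flat, mixed planes have nonnegative curvature, and horizontal planes have a
curvature bounded below by O'Neill's formula. The constants are not optimal. -/
theorem scal_coordSasaki_ge (hg : IsMetricOn g U) (h₁ : 0 < f₁) (h₂ : 0 < f₂) (hx : x ∈ U)
    (hC0 : 0 ≤ C) (hC : ∀ a b, |g x (curv g x a b b) a| ≤ C * (g x a a * g x b b)) (u : E) :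
    -((Module.finrank ℝ E : ℝ) ^ 2 * C / f₁
        + 3 * (Module.finrank ℝ E : ℝ) ^ 3 * C ^ 2 * g x u u * f₂ / f₁ ^ 2) ≤
      scal (coordSasaki g f₁ f₂) (x, u) := by
  have hS := hg.coordSasaki h₁ h₂
  have hz : (x, u) ∈ U ×ˢ (univ : Set E) := ⟨hx, trivial⟩
  obtain ⟨ε, δ, b, hε, hδ, hb, hbl, hbr⟩ := exists_adapted_basis hg h₁ h₂ hx u
  obtain ⟨η, hη⟩ := exists_orthonormalFor (hg.symm x hx) (hg.pos x hx)
  have hεε : ∀ i, g x (ε i) (ε i) = f₁⁻¹ := fun i => by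
    have : f₁ * g x (ε i) (ε i) = 1 := by simpa using hε i i
    field_simp; linarith
  have hcomm : ∀ X Y, coordSasaki g f₁ f₂ (x, u) (curv (coordSasaki g f₁ f₂) (x, u) X Y Y) X =
      coordSasaki g f₁ f₂ (x, u) (curv (coordSasaki g f₁ f₂) (x, u) Y X X) Y :=
    fun X Y => by
      rw [hS.apply_curv_pair_symm hz, IsMetricOn.curv_antisymm, map_neg, neg_apply,
        hS.apply_curv_antisymm hz, neg_neg]
  have hh : ∀ i j, -(C / f₁ + 3 * (Module.finrank ℝ E : ℝ) * C ^ 2 * g x u u * f₂ / f₁ ^ 2) ≤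
      coordSasaki g f₁ f₂ (x, u) (curv (coordSasaki g f₁ f₂) (x, u) (b (Sum.inl i))
        (b (Sum.inl j)) (b (Sum.inl j))) (b (Sum.inl i)) := by
    intro i j
    rw [hbl, hbl, curv_coordSasaki_horizontal hg h₁ h₂ hx]
    have h1 := (abs_le.1 (hC (ε i) (ε j))).1
    rw [hεε, hεε] at h1
    have h2 : g x (curv g x (ε i) (ε j) u) (curv g x (ε i) (ε j) u) ≤
        (Module.finrank ℝ E : ℝ) * ((2 * C) ^ 2 * (f₁⁻¹ * f₁⁻¹ * g x u u)) := by
      rw [hη.parseval]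
      calc _ ≤ ∑ _i : Fin (Module.finrank ℝ E), (2 * C) ^ 2 * (f₁⁻¹ * f₁⁻¹ * g x u u) := by
            refine Finset.sum_le_sum fun l _ => ?_
            have h3 := sq_curv_le hg hx hC0 hC (ε i) (ε j) u (η l)
            rw [hεε, hεε, hη.apply_eq, if_pos rfl, mul_one] at h3
            rwa [← sq]
        _ = _ := by simp
    have h3 := mul_le_mul_of_nonneg_left h1 h₁.le
    have h4 := mul_le_mul_of_nonneg_left h2 (mul_nonneg (by norm_num : (0 : ℝ) ≤ 3 / 4) h₂.le)
    have e1 : f₁ * -(C * (f₁⁻¹ * f₁⁻¹)) = -(C / f₁) := by field_simp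
    have e2 : 3 / 4 * f₂ * ((Module.finrank ℝ E : ℝ) * ((2 * C) ^ 2 * (f₁⁻¹ * f₁⁻¹ * g x u u))) =
        3 * (Module.finrank ℝ E : ℝ) * C ^ 2 * g x u u * f₂ / f₁ ^ 2 := by
      field_simp; ring
    rw [e1] at h3
    rw [e2] at h4
    linarith
  have hm : ∀ i j, 0 ≤ coordSasaki g f₁ f₂ (x, u) (curv (coordSasaki g f₁ f₂) (x, u)
      (b (Sum.inl i)) (b (Sum.inr j)) (b (Sum.inr j))) (b (Sum.inl i)) := fun i j => by
    rw [hbl, hbr]; exact curv_coordSasaki_mixed hg h₁ h₂ hx u _ _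
  have hv : ∀ i j, coordSasaki g f₁ f₂ (x, u) (curv (coordSasaki g f₁ f₂) (x, u)
      (b (Sum.inr i)) (b (Sum.inr j)) (b (Sum.inr j))) (b (Sum.inr i)) = 0 := fun i j => by
    rw [hbr, hbr]; exact curv_coordSasaki_vertical hg h₁ h₂ hx u _ _
  rw [scal_eq_sum_ric hS hz hb, Fintype.sum_sum_type]
  simp only [ric_eq_sum hb, Fintype.sum_sum_type, Finset.sum_add_distrib, hv,
    Finset.sum_const_zero, add_zero]
  have s1 := Finset.sum_le_sum fun j (_ : j ∈ Finset.univ) =>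
    Finset.sum_le_sum fun i (_ : i ∈ Finset.univ) => hh i j
  have s2 := Finset.sum_nonneg fun j (_ : j ∈ Finset.univ) =>
    Finset.sum_nonneg fun i (_ : i ∈ Finset.univ) => hm i j
  have s3 := Finset.sum_nonneg fun j (_ : j ∈ Finset.univ) =>
    Finset.sum_nonneg fun i (_ : i ∈ Finset.univ) => (hm j i).trans_eq (hcomm _ _)
  simp only [Finset.sum_const, Finset.card_univ, Fintype.card_fin, nsmul_eq_mul] at s1
  refine le_trans (le_of_eq ?_) (s1.trans ?_)
  · ring
  · linarith

end Bounds

/-! ### Charts of the tangent bundle -/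

section MF

variable {F : Type*} [NormedAddCommGroup F] [NormedSpace ℝ F]
  {F' : Type*} [NormedAddCommGroup F'] [NormedSpace ℝ F']
  {H : Type*} [TopologicalSpace H] {I : ModelWithCorners ℝ F H}
  {N : Type*} [TopologicalSpace N] [ChartedSpace H N]

/-- Tangent vectors being read in the preferred chart at their base point, so are differentials. -/
theorem mfderiv_eq_fderiv_extChartAt {ψ : F' → N} {z : F'} (h : MDifferentiableAt 𝓘(ℝ, F') I ψ z) :
    mfderiv 𝓘(ℝ, F') I ψ z = fderiv ℝ (extChartAt I (ψ z) ∘ ψ) z := by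
  rw [h.mfderiv]
  simp only [writtenInExtChartAt, extChartAt_model_space_eq_id, modelWithCornersSelf_coe, range_id,
    fderivWithin_univ]
  rfl

theorem pullbackMetric_congr (h : ∀ p : N, TangentSpace I p →L[ℝ] TangentSpace I p →L[ℝ] ℝ)
    {ψ ψ' : F' → N} {z : F'} (hψ : ψ =ᶠ[𝓝 z] ψ') :
    pullbackMetric I h ψ z = pullbackMetric I h ψ' z := by
  unfold pullbackMetric
  rw [hψ.mfderiv_eq, hψ.eq_of_nhds]

theorem pullbackMetric_comp {F'' : Type*} [NormedAddCommGroup F''] [NormedSpace ℝ F'']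
    (h : ∀ p : N, TangentSpace I p →L[ℝ] TangentSpace I p →L[ℝ] ℝ)
    {ψ : F' → N} {φ : F'' → F'} {z : F''} (hψ : MDifferentiableAt 𝓘(ℝ, F') I ψ (φ z))
    (hφ : DifferentiableAt ℝ φ z) :
    pullbackMetric I h (ψ ∘ φ) z = pull (pullbackMetric I h ψ) φ z := by
  unfold pullbackMetric
  rw [mfderiv_comp z hψ hφ.mdifferentiableAt, mfderiv_eq_fderiv]
  rfl

end MF

section TB

variable {E : Type*} [NormedAddCommGroup E] [NormedSpace ℝ E]
  {M : Type*} [TopologicalSpace M] [ChartedSpace E M] [IsManifold 𝓘(ℝ, E) ∞ M]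

theorem extChartAt_tangent_apply (u q : TangentBundle 𝓘(ℝ, E) M) :
    extChartAt 𝓘(ℝ, E).tangent u q =
      (extChartAt 𝓘(ℝ, E) u.proj q.proj,
        tangentCoordChange 𝓘(ℝ, E) q.proj u.proj q.proj q.snd) := by
  rw [FiberBundle.extChartAt]
  rfl

theorem extChartAt_tangent_target (u : TangentBundle 𝓘(ℝ, E) M) :
    (extChartAt 𝓘(ℝ, E).tangent u).target = (extChartAt 𝓘(ℝ, E) u.proj).target ×ˢ univ := by
  rw [FiberBundle.extChartAt_target, TangentBundle.trivializationAt_baseSet,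
    ← extChartAt_source 𝓘(ℝ, E), inter_eq_left.2]
  exact fun x hx => (extChartAt 𝓘(ℝ, E) u.proj).map_target hx

theorem extChartAt_tangent_symm_apply (u : TangentBundle 𝓘(ℝ, E) M) (p : E × E) :
    (extChartAt 𝓘(ℝ, E).tangent u).symm p =
      (⟨(extChartAt 𝓘(ℝ, E) u.proj).symm p.1,
        tangentCoordChange 𝓘(ℝ, E) u.proj ((extChartAt 𝓘(ℝ, E) u.proj).symm p.1)
        ((extChartAt 𝓘(ℝ, E) u.proj).symm p.1) p.2⟩ : TangentBundle 𝓘(ℝ, E) M) := by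
  rw [FiberBundle.extChartAt]
  rfl

theorem tangentCoordChange_eq_fderiv (x y z : M) :
    tangentCoordChange 𝓘(ℝ, E) x y z =
      fderiv ℝ (extChartAt 𝓘(ℝ, E) y ∘ (extChartAt 𝓘(ℝ, E) x).symm) (extChartAt 𝓘(ℝ, E) x z) := by
  rw [tangentCoordChange_def, modelWithCornersSelf_coe, range_id, fderivWithin_univ]

theorem tangentCoordChange_comp_apply {w x y z : M} (h1 : z ∈ (extChartAt 𝓘(ℝ, E) w).source)
    (h2 : z ∈ (extChartAt 𝓘(ℝ, E) x).source) (h3 : z ∈ (extChartAt 𝓘(ℝ, E) y).source) (v : E) :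
    tangentCoordChange 𝓘(ℝ, E) x y z (tangentCoordChange 𝓘(ℝ, E) w x z v) =
      tangentCoordChange 𝓘(ℝ, E) w y z v :=
  tangentCoordChange_comp ⟨⟨h1, h2⟩, h3⟩

theorem tangentCoordChange_injective {x y z : M} (h1 : z ∈ (extChartAt 𝓘(ℝ, E) x).source)
    (h2 : z ∈ (extChartAt 𝓘(ℝ, E) y).source) :
    Function.Injective (tangentCoordChange 𝓘(ℝ, E) x y z) := by
  intro v w hvw
  have h := congrArg (tangentCoordChange 𝓘(ℝ, E) y x z) hvw
  rwa [tangentCoordChange_comp_apply h1 h2 h1, tangentCoordChange_comp_apply h1 h2 h1,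
    tangentCoordChange_self h1, tangentCoordChange_self h1] at h

theorem mdifferentiableAt_extChartAt_symm {F : Type*} [NormedAddCommGroup F] [NormedSpace ℝ F]
    {H : Type*} [TopologicalSpace H] {J : ModelWithCorners ℝ F H} [J.Boundaryless]
    {N : Type*} [TopologicalSpace N] [ChartedSpace H N] [IsManifold J ∞ N] {p : N} {z : F}
    (hz : z ∈ (extChartAt J p).target) :
    MDifferentiableAt 𝓘(ℝ, F) J (extChartAt J p).symm z :=
  ((contMDiffOn_extChartAt_symm (n := ∞) p).contMDiffAt
    ((isOpen_extChartAt_target p).mem_nhds hz)).mdifferentiableAt (by simp)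

variable (h : ∀ p : M, TangentSpace 𝓘(ℝ, E) p →L[ℝ] TangentSpace 𝓘(ℝ, E) p →L[ℝ] ℝ)

theorem chartMetric_apply {y : M} {x : E} (hx : x ∈ (extChartAt 𝓘(ℝ, E) y).target) (v w : E) :
    chartMetric 𝓘(ℝ, E) h y x v w = h ((extChartAt 𝓘(ℝ, E) y).symm x)
      (tangentCoordChange 𝓘(ℝ, E) y ((extChartAt 𝓘(ℝ, E) y).symm x)
        ((extChartAt 𝓘(ℝ, E) y).symm x) v)
      (tangentCoordChange 𝓘(ℝ, E) y ((extChartAt 𝓘(ℝ, E) y).symm x)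
        ((extChartAt 𝓘(ℝ, E) y).symm x) w) := by
  have e : mfderiv 𝓘(ℝ, E) 𝓘(ℝ, E) (extChartAt 𝓘(ℝ, E) y).symm x =
      tangentCoordChange 𝓘(ℝ, E) y ((extChartAt 𝓘(ℝ, E) y).symm x)
        ((extChartAt 𝓘(ℝ, E) y).symm x) := by
    rw [mfderiv_eq_fderiv_extChartAt (mdifferentiableAt_extChartAt_symm hx),
      tangentCoordChange_eq_fderiv, (extChartAt 𝓘(ℝ, E) y).right_inv hx]
  unfold chartMetric pullbackMetric
  rw [e]
  rfl

/-- In the preferred chart at `y`, the metric at `y` is `h y` itself. -/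
theorem chartMetric_self (y : M) : chartMetric 𝓘(ℝ, E) h y (extChartAt 𝓘(ℝ, E) y y) = h y := by
  have hy := mem_extChartAt_source (I := 𝓘(ℝ, E)) y
  have key : ∀ p : M, p = y → ∀ v w : E, h p (tangentCoordChange 𝓘(ℝ, E) y p p v)
      (tangentCoordChange 𝓘(ℝ, E) y p p w) = h y v w := by
    rintro p rfl v w
    rw [tangentCoordChange_self hy, tangentCoordChange_self hy]
  refine ContinuousLinearMap.ext fun v => ContinuousLinearMap.ext fun w => ?_
  rw [chartMetric_apply h (mem_extChartAt_target y)]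
  exact key _ ((extChartAt 𝓘(ℝ, E) y).left_inv hy) v w

theorem chartMetric_apply_snd (u : TangentBundle 𝓘(ℝ, E) M) {p : E × E}
    (hp : p ∈ (extChartAt 𝓘(ℝ, E).tangent u).target) :
    chartMetric 𝓘(ℝ, E) h u.proj p.1 p.2 p.2 =
      h ((extChartAt 𝓘(ℝ, E).tangent u).symm p).proj
        ((extChartAt 𝓘(ℝ, E).tangent u).symm p).snd
        ((extChartAt 𝓘(ℝ, E).tangent u).symm p).snd := by
  rw [extChartAt_tangent_target] at hp
  rw [chartMetric_apply h hp.1, extChartAt_tangent_symm_apply]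

/-- A smooth Riemannian metric, read in a chart, is a smooth metric on the target of the chart. -/
theorem isMetricOn_chartMetric [FiniteDimensional ℝ E]
    (g : Bundle.ContMDiffRiemannianMetric 𝓘(ℝ, E) ∞ E (fun x : M => TangentSpace 𝓘(ℝ, E) x))
    (y : M) :
    IsMetricOn (chartMetric 𝓘(ℝ, E) g.inner y) (extChartAt 𝓘(ℝ, E) y).target where
  isOpen := isOpen_extChartAt_target y
  contDiffOn := by
    rw [contDiffOn_clm_apply]
    intro v
    rw [contDiffOn_clm_apply]
    intro w
    have hsm : ∀ v : E, ContMDiffOn 𝓘(ℝ, E) 𝓘(ℝ, E).tangent ∞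
        (fun x => Bundle.TotalSpace.mk' E (E := fun x : M => TangentSpace 𝓘(ℝ, E) x)
          ((extChartAt 𝓘(ℝ, E) y).symm x)
          (tangentCoordChange 𝓘(ℝ, E) y ((extChartAt 𝓘(ℝ, E) y).symm x)
            ((extChartAt 𝓘(ℝ, E) y).symm x) v))
        (extChartAt 𝓘(ℝ, E) y).target := by
      intro v
      let u : TangentBundle 𝓘(ℝ, E) M := ⟨y, 0⟩
      have h1 := contMDiffOn_extChartAt_symm (I := 𝓘(ℝ, E).tangent) (n := ∞) u
      have h2 : ContMDiffOn 𝓘(ℝ, E) 𝓘(ℝ, E × E) ∞ (fun x : E => (x, v))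
          (extChartAt 𝓘(ℝ, E) y).target :=
        (contDiff_id.prodMk contDiff_const).contMDiff.contMDiffOn
      refine (h1.comp h2 ?_).congr fun x hx => ?_
      · intro x hx
        rw [extChartAt_tangent_target]
        exact ⟨hx, trivial⟩
      · exact (extChartAt_tangent_symm_apply u (x, v)).symm
    have hc := contMDiffOn_extChartAt_symm (I := 𝓘(ℝ, E)) (n := ∞) y
    have hgc := g.contMDiff.comp_contMDiffOn hc
    have h3 : ContMDiffOn 𝓘(ℝ, E) (𝓘(ℝ, E).prod 𝓘(ℝ)) ∞
        (fun x => Bundle.TotalSpace.mk' ℝ (E := Bundle.Trivial M ℝ) ((extChartAt 𝓘(ℝ, E) y).symm x)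
          (g.inner ((extChartAt 𝓘(ℝ, E) y).symm x)
            (tangentCoordChange 𝓘(ℝ, E) y ((extChartAt 𝓘(ℝ, E) y).symm x)
              ((extChartAt 𝓘(ℝ, E) y).symm x) v)
            (tangentCoordChange 𝓘(ℝ, E) y ((extChartAt 𝓘(ℝ, E) y).symm x)
              ((extChartAt 𝓘(ℝ, E) y).symm x) w)))
        (extChartAt 𝓘(ℝ, E) y).target :=
      ContMDiffOn.clm_bundle_apply₂ (F₁ := E) (F₂ := E) hgc (hsm v) (hsm w)
    have h4 : ContMDiffOn 𝓘(ℝ, E) 𝓘(ℝ) ∞ (fun x => g.inner ((extChartAt 𝓘(ℝ, E) y).symm x)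
            (tangentCoordChange 𝓘(ℝ, E) y ((extChartAt 𝓘(ℝ, E) y).symm x)
              ((extChartAt 𝓘(ℝ, E) y).symm x) v)
            (tangentCoordChange 𝓘(ℝ, E) y ((extChartAt 𝓘(ℝ, E) y).symm x)
              ((extChartAt 𝓘(ℝ, E) y).symm x) w))
        (extChartAt 𝓘(ℝ, E) y).target := by
      intro x hx
      have := h3 x hx
      simp only [Bundle.contMDiffWithinAt_totalSpace] at this
      exact this.2
    exact h4.contDiffOn.congr fun x hx => chartMetric_apply g.inner hx v w
  symm x hx v w := by
    rw [chartMetric_apply _ hx, chartMetric_apply _ hx]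
    exact g.symm _ _ _
  pos x hx v hv := by
    rw [chartMetric_apply _ hx]
    refine g.pos _ _ fun h0 => hv ?_
    have hs := (extChartAt 𝓘(ℝ, E) y).map_target hx
    exact tangentCoordChange_injective hs (mem_extChartAt_source _) (h0.trans (map_zero _).symm)

theorem isImmersionOn_transition (x y : M) :
    IsImmersionOn (extChartAt 𝓘(ℝ, E) y ∘ (extChartAt 𝓘(ℝ, E) x).symm)
      ((extChartAt 𝓘(ℝ, E) x).symm ≫ extChartAt 𝓘(ℝ, E) y).source
      (extChartAt 𝓘(ℝ, E) y).target where
  isOpen := by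
    rw [PartialEquiv.trans_source]
    exact (continuousOn_extChartAt_symm x).isOpen_inter_preimage (isOpen_extChartAt_target x)
      (isOpen_extChartAt_source y)
  contDiffOn := contDiffOn_ext_coord_change y x
  mapsTo z hz := (extChartAt 𝓘(ℝ, E) y).map_source hz.2
  injective z hz := by
    have h1 := (extChartAt 𝓘(ℝ, E) x).map_target hz.1
    have h2 := tangentCoordChange_injective h1 hz.2
    rwa [tangentCoordChange_eq_fderiv, (extChartAt 𝓘(ℝ, E) x).right_inv hz.1] at h2

theorem fderiv_transition {x y : M} {z : E}
    (hz : z ∈ ((extChartAt 𝓘(ℝ, E) x).symm ≫ extChartAt 𝓘(ℝ, E) y).source) :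
    fderiv ℝ (extChartAt 𝓘(ℝ, E) y ∘ (extChartAt 𝓘(ℝ, E) x).symm) z =
      tangentCoordChange 𝓘(ℝ, E) x y ((extChartAt 𝓘(ℝ, E) x).symm z) := by
  rw [tangentCoordChange_eq_fderiv, (extChartAt 𝓘(ℝ, E) x).right_inv hz.1]

/-- Changes of charts are isometries of the metrics read in the charts. -/
theorem pull_chartMetric_transition {x y : M} {z : E}
    (hz : z ∈ ((extChartAt 𝓘(ℝ, E) x).symm ≫ extChartAt 𝓘(ℝ, E) y).source) :
    pull (chartMetric 𝓘(ℝ, E) h y) (extChartAt 𝓘(ℝ, E) y ∘ (extChartAt 𝓘(ℝ, E) x).symm) z =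
      chartMetric 𝓘(ℝ, E) h x z := by
  have hz2 : (extChartAt 𝓘(ℝ, E) x).symm z ∈ (extChartAt 𝓘(ℝ, E) y).source := hz.2
  refine ContinuousLinearMap.ext fun v => ContinuousLinearMap.ext fun w => ?_
  rw [pull_apply, fderiv_transition hz, chartMetric_apply h hz.1, Function.comp_apply,
    chartMetric_apply h ((extChartAt 𝓘(ℝ, E) y).map_source hz2)]
  rw [(extChartAt 𝓘(ℝ, E) y).left_inv hz2]
  have hz1 := (extChartAt 𝓘(ℝ, E) x).map_target hz.1
  rw [tangentCoordChange_comp_apply hz1 hz2 (mem_extChartAt_source _),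
    tangentCoordChange_comp_apply hz1 hz2 (mem_extChartAt_source _)]

theorem dproj_eq (u : TangentBundle 𝓘(ℝ, E) M) : dproj u = ContinuousLinearMap.fst ℝ E E := by
  have hd : MDifferentiableAt 𝓘(ℝ, E).tangent 𝓘(ℝ, E)
      (Bundle.TotalSpace.proj : TangentBundle 𝓘(ℝ, E) M → M) u :=
    (Bundle.contMDiffAt_proj (n := ∞) (fun x : M => TangentSpace 𝓘(ℝ, E) x)).mdifferentiableAt
      (by simp)
  unfold dproj
  rw [hd.mfderiv]
  have hr : range 𝓘(ℝ, E).tangent = univ := ModelWithCorners.range_eq_univ _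
  rw [hr, fderivWithin_univ]
  have hev : writtenInExtChartAt 𝓘(ℝ, E).tangent 𝓘(ℝ, E) u
      (Bundle.TotalSpace.proj : TangentBundle 𝓘(ℝ, E) M → M) =ᶠ[𝓝 (extChartAt 𝓘(ℝ, E).tangent u u)]
      Prod.fst := by
    filter_upwards [extChartAt_target_mem_nhds (I := 𝓘(ℝ, E).tangent) u] with p hp
    rw [extChartAt_tangent_target] at hp
    simp only [writtenInExtChartAt, Function.comp_apply, extChartAt_tangent_symm_apply]
    exact (extChartAt 𝓘(ℝ, E) u.proj).right_inv hp.1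
  rw [hev.fderiv_eq, fderiv_fst]

theorem extChartAt_tangent_self (u : TangentBundle 𝓘(ℝ, E) M) :
    extChartAt 𝓘(ℝ, E).tangent u u = (extChartAt 𝓘(ℝ, E) u.proj u.proj, u.snd) := by
  rw [extChartAt_tangent_apply]
  exact Prod.ext rfl (tangentCoordChange_self (mem_extChartAt_source _))

/-- In the preferred chart, the Sasaki metric is its coordinate expression at the base point of the
chart. -/
theorem sasakiMetric_eq (f₁ f₂ : ℝ) (u : TangentBundle 𝓘(ℝ, E) M) :
    sasakiMetric h f₁ f₂ u =
      coordSasaki (chartMetric 𝓘(ℝ, E) h u.proj) f₁ f₂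
        (extChartAt 𝓘(ℝ, E) u.proj u.proj, u.snd) := by
  unfold sasakiMetric coordSasaki
  rw [dproj_eq, chartMetric_self]
  rfl

theorem coordSasaki_congr {g g' : E → E →L[ℝ] E →L[ℝ] ℝ} {p : E × E} (hg : g =ᶠ[𝓝 p.1] g')
    (f₁ f₂ : ℝ) : coordSasaki g f₁ f₂ p = coordSasaki g' f₁ f₂ p := by
  unfold coordSasaki coordConn
  rw [hg.eq_of_nhds, christoffel_congr hg]

end TB

section TB

variable {E : Type*} [NormedAddCommGroup E] [NormedSpace ℝ E] [FiniteDimensional ℝ E]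
  {M : Type*} [TopologicalSpace M] [ChartedSpace E M] [IsManifold 𝓘(ℝ, E) ∞ M]
  (g : Bundle.ContMDiffRiemannianMetric 𝓘(ℝ, E) ∞ E (fun x : M => TangentSpace 𝓘(ℝ, E) x))

/-- The Sasaki metric, read in a chart of `TM` induced by a chart of `M`. At a point `q` of the
chart it is defined by the chart at `q`; the change of charts of `TM` is the tangent map of an
isometry, and thus an isometry of the Sasaki metrics in coordinates. -/
theorem chartMetric_sasakiMetric (f₁ f₂ : ℝ) (u : TangentBundle 𝓘(ℝ, E) M) {p : E × E}
    (hp : p ∈ (extChartAt 𝓘(ℝ, E).tangent u).target) :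
    chartMetric 𝓘(ℝ, E).tangent (sasakiMetric g.inner f₁ f₂) u p =
      coordSasaki (chartMetric 𝓘(ℝ, E) g.inner u.proj) f₁ f₂ p := by
  obtain ⟨x, v⟩ := p
  have hd := mdifferentiableAt_extChartAt_symm hp
  have hxt : x ∈ (extChartAt 𝓘(ℝ, E) u.proj).target := by
    rw [extChartAt_tangent_target] at hp; exact hp.1
  have hu := extChartAt_tangent_symm_apply u (x, v)
  set q := (extChartAt 𝓘(ℝ, E).tangent u).symm (x, v) with hq
  set τ : E → E := extChartAt 𝓘(ℝ, E) q.proj ∘ (extChartAt 𝓘(ℝ, E) u.proj).symm with hτ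
  have hqp : q.proj = (extChartAt 𝓘(ℝ, E) u.proj).symm x := by rw [hu]
  have him : IsImmersionOn τ _ _ := isImmersionOn_transition u.proj q.proj
  have hxV : x ∈ ((extChartAt 𝓘(ℝ, E) u.proj).symm ≫ extChartAt 𝓘(ℝ, E) q.proj).source := by
    refine ⟨hxt, ?_⟩
    change (extChartAt 𝓘(ℝ, E) u.proj).symm x ∈ (extChartAt 𝓘(ℝ, E) q.proj).source
    rw [← hqp]
    exact mem_extChartAt_source _
  have hG := isMetricOn_chartMetric g q.proj
  have hsurj : Function.Surjective (fderiv ℝ τ x) :=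
    LinearMap.injective_iff_surjective (f := (fderiv ℝ τ x : E →ₗ[ℝ] E)).1 (him.injective x hxV)
  have hV : ∀ᶠ x' in 𝓝 x,
      x' ∈ ((extChartAt 𝓘(ℝ, E) u.proj).symm ≫ extChartAt 𝓘(ℝ, E) q.proj).source :=
    him.mem_nhds hxV
  -- in the charts at `u` and `q`, the identity of `TM` is the tangent map of the change of charts
  have hT : (extChartAt 𝓘(ℝ, E).tangent q ∘ (extChartAt 𝓘(ℝ, E).tangent u).symm) =ᶠ[𝓝 (x, v)]
      tmap τ := by
    filter_upwards [continuousAt_fst.eventually hV] with p hp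
    rw [Function.comp_apply, extChartAt_tangent_symm_apply, extChartAt_tangent_apply]
    refine Prod.ext rfl ?_
    simp only [tmap, hτ]
    rw [fderiv_transition hp]
    exact tangentCoordChange_comp_apply ((extChartAt 𝓘(ℝ, E) u.proj).map_target hp.1)
      (mem_extChartAt_source _) hp.2 _
  have hmf : mfderiv 𝓘(ℝ, E × E) 𝓘(ℝ, E).tangent (extChartAt 𝓘(ℝ, E).tangent u).symm (x, v) =
      fderiv ℝ (tmap τ) (x, v) := by
    rw [mfderiv_eq_fderiv_extChartAt hd, hT.fderiv_eq]
  have hpt : ((extChartAt 𝓘(ℝ, E) q.proj q.proj, q.snd) : E × E) = tmap τ (x, v) :=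
    (extChartAt_tangent_self q).symm.trans hT.eq_of_nhds
  have hs := (sasakiMetric_eq g.inner f₁ f₂ q).trans
    (congrArg (coordSasaki (chartMetric 𝓘(ℝ, E) g.inner q.proj) f₁ f₂) hpt)
  have h1 : chartMetric 𝓘(ℝ, E).tangent (sasakiMetric g.inner f₁ f₂) u (x, v) =
      pull (coordSasaki (chartMetric 𝓘(ℝ, E) g.inner q.proj) f₁ f₂) (tmap τ) (x, v) := by
    refine ContinuousLinearMap.ext fun X => ContinuousLinearMap.ext fun Y => ?_
    change sasakiMetric g.inner f₁ f₂ q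
      (mfderiv 𝓘(ℝ, E × E) 𝓘(ℝ, E).tangent (extChartAt 𝓘(ℝ, E).tangent u).symm (x, v) X)
      (mfderiv 𝓘(ℝ, E × E) 𝓘(ℝ, E).tangent (extChartAt 𝓘(ℝ, E).tangent u).symm (x, v) Y) = _
    rw [hmf]
    exact DFunLike.congr_fun (DFunLike.congr_fun hs _) _
  rw [h1, pull_coordSasaki_tmap him hG hxV hsurj]
  refine coordSasaki_congr ?_ f₁ f₂
  filter_upwards [hV] with x' hx'
  exact pull_chartMetric_transition g.inner hx'

/-- A local parametrization of the sphere bundle, read in the chart at a point. -/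
theorem IsLocalParam.exists_isImmersionOn {d : ℕ} {r : ℝ}
    {V : Set (EuclideanSpace ℝ (Fin d))} {ψ : EuclideanSpace ℝ (Fin d) → TangentBundle 𝓘(ℝ, E) M}
    (hψ : IsLocalParam 𝓘(ℝ, E).tangent (sphereBundle g.inner r) V ψ)
    {z : EuclideanSpace ℝ (Fin d)} (hz : z ∈ V) :
    ∃ (φ : EuclideanSpace ℝ (Fin d) → E × E) (V' : Set (EuclideanSpace ℝ (Fin d))),
      z ∈ V' ∧ IsImmersionOn φ V' ((extChartAt 𝓘(ℝ, E) (ψ z).proj).target ×ˢ univ) ∧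
      (∀ z' ∈ V', chartMetric 𝓘(ℝ, E) g.inner (ψ z).proj (φ z').1 (φ z').2 (φ z').2 = r ^ 2) ∧
      φ z = extChartAt 𝓘(ℝ, E).tangent (ψ z) (ψ z) ∧
      mfderiv 𝓘(ℝ, EuclideanSpace ℝ (Fin d)) 𝓘(ℝ, E).tangent ψ z = fderiv ℝ φ z ∧
      ∀ f₁ f₂ : ℝ, pullbackMetric 𝓘(ℝ, E).tangent (sasakiMetric g.inner f₁ f₂) ψ =ᶠ[𝓝 z]
        pull (coordSasaki (chartMetric 𝓘(ℝ, E) g.inner (ψ z).proj) f₁ f₂) φ := by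
  set e := extChartAt 𝓘(ℝ, E).tangent (ψ z) with he
  set φ := e ∘ ψ with hφ
  set V' := V ∩ ψ ⁻¹' e.source with hV'
  have hopen : IsOpen V' := hψ.contMDiffOn.continuousOn.isOpen_inter_preimage hψ.isOpen
    (isOpen_extChartAt_source (I := 𝓘(ℝ, E).tangent) (ψ z))
  have hzV' : z ∈ V' := ⟨hz, mem_extChartAt_source (I := 𝓘(ℝ, E).tangent) (ψ z)⟩
  have hsmooth : ContDiffOn ℝ ∞ φ V' := by
    have h1 := contMDiffOn_extChartAt (I := 𝓘(ℝ, E).tangent) (n := ∞) (x := ψ z)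
    rw [← extChartAt_source 𝓘(ℝ, E).tangent] at h1
    exact (h1.comp (hψ.contMDiffOn.mono inter_subset_left) fun z' hz' => hz'.2).contDiffOn
  have hmaps : ∀ z' ∈ V', φ z' ∈ e.target := fun z' hz' => e.map_source hz'.2
  have hev : ∀ z' ∈ V', ψ =ᶠ[𝓝 z'] e.symm ∘ φ := by
    intro z' hz'
    filter_upwards [hopen.mem_nhds hz'] with y hy
    exact (e.left_inv hy.2).symm
  have hdφ : ∀ z' ∈ V', DifferentiableAt ℝ φ z' := fun z' hz' =>
    (hsmooth.contDiffAt (hopen.mem_nhds hz')).differentiableAt (by simp)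
  have hdψ : MDifferentiableAt 𝓘(ℝ, EuclideanSpace ℝ (Fin d)) 𝓘(ℝ, E).tangent ψ z :=
    (hψ.contMDiffOn.contMDiffAt (hψ.isOpen.mem_nhds hz)).mdifferentiableAt (by simp)
  refine ⟨φ, V', hzV', ⟨hopen, hsmooth, ?_, ?_⟩, ?_, rfl, ?_, ?_⟩
  · intro z' hz'
    have := hmaps z' hz'
    rwa [he, extChartAt_tangent_target] at this
  · intro z' hz'
    have h1 := hψ.injective_mfderiv z' hz'.1
    rw [(hev z' hz').mfderiv_eq, mfderiv_comp z' (mdifferentiableAt_extChartAt_symm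
      (hmaps z' hz')) (hdφ z' hz').mdifferentiableAt, mfderiv_eq_fderiv] at h1
    exact Function.Injective.of_comp h1
  · intro z' hz'
    have h1 : ψ z' ∈ sphereBundle g.inner r := by
      obtain ⟨O, -, hO⟩ := hψ.image_eq
      have : ψ z' ∈ ψ '' V := mem_image_of_mem ψ hz'.1
      rw [hO] at this
      exact this.1
    rw [chartMetric_apply_snd g.inner (ψ z) (hmaps z' hz')]
    have h2 : (extChartAt 𝓘(ℝ, E).tangent (ψ z)).symm (φ z') = ψ z' := e.left_inv hz'.2
    rw [h2]
    exact h1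
  · exact mfderiv_eq_fderiv_extChartAt hdψ
  · intro f₁ f₂
    filter_upwards [hopen.mem_nhds hzV'] with z' hz'
    rw [pullbackMetric_congr _ (hev z' hz'), pullbackMetric_comp _
      (mdifferentiableAt_extChartAt_symm (hmaps z' hz')) (hdφ z' hz')]
    have h1 := chartMetric_sasakiMetric g f₁ f₂ (ψ z) (hmaps z' hz')
    unfold chartMetric at h1
    unfold pull
    rw [h1]
    rfl

end TB

/-! ### The sphere bundle as a submanifold -/

section LocalParam

variable {F : Type*} [NormedAddCommGroup F] [NormedSpace ℝ F]
  {H : Type*} [TopologicalSpace H] {J : ModelWithCorners ℝ F H}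
  {N : Type*} [TopologicalSpace N] [ChartedSpace H N] [IsManifold J ∞ N]

/-- A smooth map into the target of a chart is a local parametrization of `S` as soon as its image
is the part of `S` in an open set `T`, on which it has a smooth left inverse. -/
theorem isLocalParam_of_leftInverse {d : ℕ} {S : Set N} {p : N} {T : Set F} (hT : IsOpen T)
    (hTe : T ⊆ (extChartAt J p).target) {V : Set (EuclideanSpace ℝ (Fin d))} (hV : IsOpen V)
    {φ : EuclideanSpace ℝ (Fin d) → F} (hφ : ContDiffOn ℝ ∞ φ V)
    {χ : F → EuclideanSpace ℝ (Fin d)} (hχ : ContDiffOn ℝ ∞ χ T)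
    (hinv : ∀ z ∈ V, χ (φ z) = z) (himg : φ '' V = T ∩ (extChartAt J p).symm ⁻¹' S) :
    IsLocalParam J S V ((extChartAt J p).symm ∘ φ) := by
  set e := extChartAt J p with he
  have hφT : ∀ z ∈ V, φ z ∈ T := fun z hz => (himg.subset (mem_image_of_mem φ hz)).1
  have hψ : ContMDiffOn 𝓘(ℝ, EuclideanSpace ℝ (Fin d)) J ∞ (e.symm ∘ φ) V :=
    (contMDiffOn_extChartAt_symm p).comp hφ.contMDiffOn fun z hz => hTe (hφT z hz)
  set O : Set N := e.source ∩ e ⁻¹' T with hO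
  have hOo : IsOpen O := (continuousOn_extChartAt p).isOpen_inter_preimage
    (isOpen_extChartAt_source p) hT
  have hψO : ∀ z ∈ V, (e.symm ∘ φ) z ∈ O := fun z hz => by
    refine ⟨e.map_target (hTe (hφT z hz)), ?_⟩
    change e (e.symm (φ z)) ∈ T
    rw [e.right_inv (hTe (hφT z hz))]
    exact hφT z hz
  have hχe : ContMDiffOn J 𝓘(ℝ, EuclideanSpace ℝ (Fin d)) ∞ (χ ∘ e) O := by
    have h1 := contMDiffOn_extChartAt (I := J) (n := ∞) (x := p)
    rw [← extChartAt_source J] at h1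
    exact hχ.contMDiffOn.comp (h1.mono inter_subset_left) fun q hq => hq.2
  have hleft : ∀ z ∈ V, (χ ∘ e) ((e.symm ∘ φ) z) = z := fun z hz => by
    rw [Function.comp_apply, Function.comp_apply, e.right_inv (hTe (hφT z hz)), hinv z hz]
  refine ⟨hV, hψ, fun z hz => ?_, ?_, O, hOo, ?_⟩
  · have h1 : MDifferentiableAt J 𝓘(ℝ, EuclideanSpace ℝ (Fin d)) (χ ∘ e) ((e.symm ∘ φ) z) :=
      (hχe.contMDiffAt (hOo.mem_nhds (hψO z hz))).mdifferentiableAt (by simp)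
    have h2 : MDifferentiableAt 𝓘(ℝ, EuclideanSpace ℝ (Fin d)) J (e.symm ∘ φ) z :=
      (hψ.contMDiffAt (hV.mem_nhds hz)).mdifferentiableAt (by simp)
    have h3 : (χ ∘ e) ∘ (e.symm ∘ φ) =ᶠ[𝓝 z] id := by
      filter_upwards [hV.mem_nhds hz] with y hy
      exact hleft y hy
    have h4 := h3.mfderiv_eq (I := 𝓘(ℝ, EuclideanSpace ℝ (Fin d)))
      (I' := 𝓘(ℝ, EuclideanSpace ℝ (Fin d)))
    rw [mfderiv_comp z h1 h2, mfderiv_id] at h4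
    intro v w hvw
    have h5 : ∀ y : EuclideanSpace ℝ (Fin d),
        mfderiv J 𝓘(ℝ, EuclideanSpace ℝ (Fin d)) (χ ∘ e) ((e.symm ∘ φ) z)
          (mfderiv 𝓘(ℝ, EuclideanSpace ℝ (Fin d)) J (e.symm ∘ φ) z y) = y :=
      fun y => DFunLike.congr_fun h4 y
    exact (h5 v).symm.trans ((congrArg _ hvw).trans (h5 w))
  · let f : V → O := fun z => ⟨(e.symm ∘ φ) z, hψO z z.2⟩
    have hf : Continuous f :=
      (continuousOn_iff_continuous_domRestrict.1 hψ.continuousOn).subtype_mk _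
    have hc : Continuous (O.domRestrict (χ ∘ e)) :=
      continuousOn_iff_continuous_domRestrict.1 hχe.continuousOn
    have hcf : O.domRestrict (χ ∘ e) ∘ f = Subtype.val := funext fun z => hleft z z.2
    have h1 : Topology.IsEmbedding f :=
      .of_comp hf hc (hcf ▸ Topology.IsEmbedding.subtypeVal)
    exact Topology.IsEmbedding.subtypeVal.comp h1
  · ext q
    constructor
    · rintro ⟨z, hz, rfl⟩
      exact ⟨(himg.subset (mem_image_of_mem φ hz)).2, hψO z hz⟩
    · rintro ⟨hqS, hqe, hqT⟩
      have h1 : e q ∈ φ '' V := by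
        rw [himg]
        refine ⟨hqT, ?_⟩
        change e.symm (e q) ∈ S
        rwa [e.left_inv hqe]
      obtain ⟨z, hz, hzq⟩ := h1
      refine ⟨z, hz, ?_⟩
      rw [Function.comp_apply, hzq, e.left_inv hqe]

end LocalParam

section Sphere

variable {E : Type*} [NormedAddCommGroup E] [NormedSpace ℝ E] [FiniteDimensional ℝ E]
  {M : Type*} [TopologicalSpace M] [ChartedSpace E M] [IsManifold 𝓘(ℝ, E) ∞ M]
  (g : Bundle.ContMDiffRiemannianMetric 𝓘(ℝ, E) ∞ E (fun x : M => TangentSpace 𝓘(ℝ, E) x))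

/-- Near one of its points, a sphere bundle in coordinates is parametrized by the radial projection
from the affine hyperplane tangent to the sphere at that point. -/
theorem exists_sphere_param {G : E → E →L[ℝ] E →L[ℝ] ℝ} {U : Set E} (hG : IsMetricOn G U)
    {r : ℝ} (hr : 0 < r) {x₀ u₀ : E} (hx₀ : x₀ ∈ U) (hu₀ : G x₀ u₀ u₀ = r ^ 2) :
    ∃ (T : Set (E × E)) (V : Set (EuclideanSpace ℝ (Fin (2 * Module.finrank ℝ E - 1))))
      (φ : EuclideanSpace ℝ (Fin (2 * Module.finrank ℝ E - 1)) → E × E)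
      (χ : E × E → EuclideanSpace ℝ (Fin (2 * Module.finrank ℝ E - 1))),
      IsOpen T ∧ T ⊆ U ×ˢ univ ∧ (x₀, u₀) ∈ T ∧ IsOpen V ∧ ContDiffOn ℝ ∞ φ V ∧
      ContDiffOn ℝ ∞ χ T ∧ (∀ z ∈ V, χ (φ z) = z) ∧
      φ '' V = T ∩ {p | G p.1 p.2 p.2 = r ^ 2} := by
  set l : E →L[ℝ] ℝ := G x₀ u₀ with hl
  have hl0 : 0 < l u₀ := by rw [hu₀]; positivity
  set W : Submodule ℝ E := LinearMap.ker (l : E →ₗ[ℝ] ℝ) with hW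
  have hne : (l : E →ₗ[ℝ] ℝ) ≠ 0 := fun h0 => hl0.ne' (DFunLike.congr_fun h0 u₀)
  have hfr : Module.finrank ℝ W + 1 = Module.finrank ℝ E :=
    Module.Dual.finrank_ker_add_one_of_ne_zero hne
  have hd : Module.finrank ℝ (EuclideanSpace ℝ (Fin (2 * Module.finrank ℝ E - 1))) =
      Module.finrank ℝ (E × W) := by
    rw [finrank_euclideanSpace_fin, Module.finrank_prod]
    omega
  let L := ContinuousLinearEquiv.ofFinrankEq hd
  -- the projection onto `W` along `u₀`
  let P : E →L[ℝ] W := (ContinuousLinearMap.id ℝ E - ((l u₀)⁻¹ • l).smulRight u₀).codRestrict W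
    (fun v => by simp [hW]; field_simp; ring)
  have hP : ∀ v, (P v : E) = v - ((l u₀)⁻¹ * l v) • u₀ := fun v => rfl
  have hlW : ∀ w : W, l w = 0 := fun w => w.2
  have hpos : ∀ x ∈ U, ∀ y, 0 < l y → 0 < G x y y := fun x hx y hy =>
    hG.pos x hx y fun h0 => by simp [h0] at hy
  have hly : ∀ w : W, l (u₀ + w) = l u₀ := fun w => by rw [map_add, hlW, add_zero]
  let φ' : E × W → E × E := fun p =>
    (p.1, (r / √(G p.1 (u₀ + p.2) (u₀ + p.2))) • (u₀ + p.2))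
  have hcpos : ∀ x ∈ U, ∀ w : W, 0 < r / √(G x (u₀ + w) (u₀ + w)) := fun x hx w =>
    div_pos hr (Real.sqrt_pos.2 (hpos x hx _ (by rw [hly]; exact hl0)))
  let χ' : E × E → E × W := fun p => (p.1, (l u₀ / l p.2) • P p.2)
  have hφ' : ContDiffOn ℝ ∞ φ' (U ×ˢ univ) := by
    have h1 : ContDiff ℝ ∞ (fun p : E × W => u₀ + (p.2 : E)) :=
      contDiff_const.add (W.subtypeL.contDiff.comp contDiff_snd)
    have h2 : ContDiffOn ℝ ∞ (fun p : E × W => G p.1 (u₀ + p.2) (u₀ + p.2)) (U ×ˢ univ) :=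
      ((hG.contDiffOn.comp contDiff_fst.contDiffOn fun p hp => hp.1).clm_apply
        h1.contDiffOn).clm_apply h1.contDiffOn
    have hp0 : ∀ p ∈ U ×ˢ (univ : Set W), 0 < G p.1 (u₀ + p.2) (u₀ + p.2) := fun p hp =>
      hpos p.1 hp.1 _ (by rw [hly]; exact hl0)
    exact contDiff_fst.contDiffOn.prodMk ((contDiffOn_const.div (h2.sqrt fun p hp => (hp0 p hp).ne')
      fun p hp => (Real.sqrt_pos.2 (hp0 p hp)).ne').smul h1.contDiffOn)
  have hTo : IsOpen (U ×ˢ {u | 0 < l u}) :=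
    hG.isOpen.prod (isOpen_lt continuous_const l.continuous)
  have hχ' : ContDiffOn ℝ ∞ χ' (U ×ˢ {u | 0 < l u}) :=
    contDiff_fst.contDiffOn.prodMk ((contDiffOn_const.div
      (l.contDiff.comp contDiff_snd).contDiffOn fun p hp => (ne_of_gt hp.2)).smul
      (P.contDiff.comp contDiff_snd).contDiffOn)
  have hinv : ∀ p ∈ U ×ˢ (univ : Set W), χ' (φ' p) = p := by
    rintro ⟨x, w⟩ ⟨hx, -⟩
    have hc := hcpos x hx w
    refine Prod.ext rfl (Subtype.ext ?_)
    simp only [χ', φ', Submodule.coe_smul, hP, map_smul, hly, smul_eq_mul]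
    set c := r / √(G x (u₀ + w) (u₀ + w))
    match_scalars <;> field_simp
    ring
  refine ⟨U ×ˢ {u | 0 < l u}, L ⁻¹' (U ×ˢ univ), φ' ∘ L, L.symm ∘ χ', hTo,
    prod_mono_right (subset_univ _), ⟨hx₀, hl0⟩,
    (hG.isOpen.prod isOpen_univ).preimage L.continuous,
    hφ'.comp L.contDiff.contDiffOn fun z hz => hz, L.symm.contDiff.comp_contDiffOn hχ',
    fun z hz => ?_, ?_⟩
  · rw [Function.comp_apply, Function.comp_apply, hinv _ hz, L.symm_apply_apply]
  · rw [image_comp, image_preimage_eq _ L.surjective]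
    refine Subset.antisymm ?_ ?_
    · rintro _ ⟨⟨x', w⟩, ⟨hx, -⟩, rfl⟩
      have hc := hcpos x' hx w
      refine ⟨⟨hx, ?_⟩, ?_⟩
      · simp only [φ', mem_ofPred_eq, map_smul, hly, smul_eq_mul]
        exact mul_pos hc hl0
      · have h0 : 0 < G x' (u₀ + w) (u₀ + w) := hpos x' hx _ (by rw [hly]; exact hl0)
        simp only [φ', mem_ofPred_eq, map_smul, smul_apply, smul_eq_mul]
        have h1 := Real.sq_sqrt h0.le
        have h2 := (Real.sqrt_pos.2 h0).ne'
        rw [← mul_assoc, ← sq, div_pow, h1]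
        exact div_mul_cancel₀ _ h0.ne'
    · rintro ⟨x, u⟩ ⟨⟨hx, hu⟩, hn⟩
      change 0 < l u at hu
      change G x u u = r ^ 2 at hn
      refine ⟨χ' (x, u), ⟨hx, trivial⟩, Prod.ext rfl ?_⟩
      have h1 : u₀ + ((χ' (x, u)).2 : E) = (l u₀ / l u) • u := by
        simp only [χ', Submodule.coe_smul, hP]
        match_scalars <;> field_simp
        ring
      have ha : 0 < l u₀ / l u := div_pos hl0 hu
      change (r / √(G x (u₀ + ((χ' (x, u)).2 : E)) (u₀ + ((χ' (x, u)).2 : E)))) •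
        (u₀ + ((χ' (x, u)).2 : E)) = u
      rw [h1]
      simp only [map_smul, smul_apply, smul_eq_mul, hn]
      rw [show l u₀ / l u * (l u₀ / l u * r ^ 2) = (l u₀ / l u * r) ^ 2 by ring,
        Real.sqrt_sq (mul_pos ha hr).le, smul_smul, show r / (l u₀ / l u * r) * (l u₀ / l u) = 1 by
          field_simp, one_smul]

/-- The sphere bundle of radius `r > 0` is a hypersurface of the tangent bundle. -/
theorem isSubmanifold_sphereBundle {r : ℝ} (hr : 0 < r) :
    IsSubmanifold 𝓘(ℝ, E).tangent (2 * Module.finrank ℝ E - 1) (sphereBundle g.inner r) := by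
  intro u₀ hu₀
  have hG := isMetricOn_chartMetric g u₀.proj
  have h0 : chartMetric 𝓘(ℝ, E) g.inner u₀.proj (extChartAt 𝓘(ℝ, E) u₀.proj u₀.proj) u₀.snd u₀.snd
      = r ^ 2 := by
    rw [chartMetric_self]
    exact hu₀
  obtain ⟨T, V, φ, χ, hT, hTU, h0T, hV, hφ, hχ, hinv, himg⟩ :=
    exists_sphere_param hG hr (mem_extChartAt_target u₀.proj) h0
  rw [← extChartAt_tangent_target] at hTU
  have himg' : φ '' V = T ∩ (extChartAt 𝓘(ℝ, E).tangent u₀).symm ⁻¹' sphereBundle g.inner r := by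
    rw [himg]
    ext p
    refine and_congr_right fun hp => ?_
    change _ = _ ↔ _ = _
    rw [chartMetric_apply_snd g.inner u₀ (hTU hp)]
  refine ⟨V, _, isLocalParam_of_leftInverse hT hTU hV hφ hχ hinv himg', ?_⟩
  have h1 : ((extChartAt 𝓘(ℝ, E) u₀.proj u₀.proj, u₀.snd) : E × E) ∈ φ '' V := by
    rw [himg]
    exact ⟨h0T, h0⟩
  obtain ⟨z, hz, hzu⟩ := h1
  refine ⟨z, hz, ?_⟩
  rw [Function.comp_apply, hzu]
  refine (congrArg (extChartAt 𝓘(ℝ, E).tangent u₀).symm (extChartAt_tangent_self u₀).symm).trans ?_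
  exact (extChartAt 𝓘(ℝ, E).tangent u₀).left_inv (mem_extChartAt_source _)

end Sphere

/-! ### Curvatures of the sphere bundle -/

section Sphere

variable {E : Type*} [NormedAddCommGroup E] [NormedSpace ℝ E] [FiniteDimensional ℝ E]
  {M : Type*} [TopologicalSpace M] [ChartedSpace E M] [IsManifold 𝓘(ℝ, E) ∞ M]
  (g : Bundle.ContMDiffRiemannianMetric 𝓘(ℝ, E) ∞ E (fun x : M => TangentSpace 𝓘(ℝ, E) x))

/-- Near `u`, the Sasaki metric agrees with its coordinate expression, so that its curvatures at `u`
can be computed from the latter. -/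
theorem chartMetric_sasakiMetric_eventuallyEq (f₁ f₂ : ℝ) (u : TangentBundle 𝓘(ℝ, E) M) :
    chartMetric 𝓘(ℝ, E).tangent (sasakiMetric g.inner f₁ f₂) u
      =ᶠ[𝓝 (extChartAt 𝓘(ℝ, E).tangent u u)]
      coordSasaki (chartMetric 𝓘(ℝ, E) g.inner u.proj) f₁ f₂ := by
  filter_upwards [extChartAt_target_mem_nhds (I := 𝓘(ℝ, E).tangent) u] with p hp
  exact chartMetric_sasakiMetric g f₁ f₂ u hp

/-- The Ricci and scalar curvatures of the tangent sphere bundle, compared with those of the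
tangent bundle. The Ricci tensors differ by a multiple of the vertical part of the metric. -/
theorem IsLocalParam.ric_scal {d : ℕ} {r : ℝ} (hr : 0 < r)
    {V : Set (EuclideanSpace ℝ (Fin d))} {ψ : EuclideanSpace ℝ (Fin d) → TangentBundle 𝓘(ℝ, E) M}
    (hψ : IsLocalParam 𝓘(ℝ, E).tangent (sphereBundle g.inner r) V ψ)
    (hd : d + 1 = 2 * Module.finrank ℝ E) {f₁ f₂ : ℝ} (h₁ : 0 < f₁) (h₂ : 0 < f₂)
    {z : EuclideanSpace ℝ (Fin d)} (hz : z ∈ V) :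
    (∀ v w : EuclideanSpace ℝ (Fin d),
      ric (pullbackMetric 𝓘(ℝ, E).tangent (sasakiMetric g.inner f₁ f₂) ψ) z v w =
        ricAt 𝓘(ℝ, E).tangent (sasakiMetric g.inner f₁ f₂) (ψ z)
          (mfderiv 𝓘(ℝ, EuclideanSpace ℝ (Fin d)) 𝓘(ℝ, E).tangent ψ z v)
          (mfderiv 𝓘(ℝ, EuclideanSpace ℝ (Fin d)) 𝓘(ℝ, E).tangent ψ z w) +
        (Module.finrank ℝ E - 2) / (f₂ * r ^ 2) *
          vertForm (chartMetric 𝓘(ℝ, E) g.inner (ψ z).proj) f₂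
            (extChartAt 𝓘(ℝ, E).tangent (ψ z) (ψ z))
            (mfderiv 𝓘(ℝ, EuclideanSpace ℝ (Fin d)) 𝓘(ℝ, E).tangent ψ z v)
            (mfderiv 𝓘(ℝ, EuclideanSpace ℝ (Fin d)) 𝓘(ℝ, E).tangent ψ z w)) ∧
    scal (pullbackMetric 𝓘(ℝ, E).tangent (sasakiMetric g.inner f₁ f₂) ψ) z =
      scalAt 𝓘(ℝ, E).tangent (sasakiMetric g.inner f₁ f₂) (ψ z) +
        (Module.finrank ℝ E - 1) * (Module.finrank ℝ E - 2) / (f₂ * r ^ 2) := by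
  obtain ⟨φ, V', hzV', hφ, hφr, hφz, hmf, hpull⟩ := hψ.exists_isImmersionOn g hz
  have hG := isMetricOn_chartMetric g (ψ z).proj
  obtain ⟨h3, h4⟩ := ric_scal_hypersurface hG h₁ h₂ hr hφ hφr
    (by rw [finrank_euclideanSpace_fin, hd]) hzV'
  have hs := chartMetric_sasakiMetric_eventuallyEq g f₁ f₂ (ψ z)
  rw [hφz] at h3 h4
  unfold ricAt scalAt
  rw [ric_congr (hpull f₁ f₂), scal_congr (hpull f₁ f₂), ric_congr hs, hmf]
  refine ⟨h3, h4.trans ?_⟩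
  rw [scal_congr hs]

variable {g} in
/-- A bound of the sectional curvatures bounds the curvature form on all pairs of vectors. -/
theorem BoundedSectionalCurvature.exists_bound
    (hK : BoundedSectionalCurvature 𝓘(ℝ, E) g.inner) :
    ∃ C : ℝ, 0 ≤ C ∧ ∀ (p : M) (a b : E),
      |chartMetric 𝓘(ℝ, E) g.inner p (extChartAt 𝓘(ℝ, E) p p)
        (curv (chartMetric 𝓘(ℝ, E) g.inner p) (extChartAt 𝓘(ℝ, E) p p) a b b) a| ≤
      C * (chartMetric 𝓘(ℝ, E) g.inner p (extChartAt 𝓘(ℝ, E) p p) a a *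
        chartMetric 𝓘(ℝ, E) g.inner p (extChartAt 𝓘(ℝ, E) p p) b b) := by
  obtain ⟨C, hC⟩ := hK
  refine ⟨max C 0, le_max_right _ _, fun p a b => ?_⟩
  have hp := mem_extChartAt_target (I := 𝓘(ℝ, E)) p
  have hG := isMetricOn_chartMetric g p
  have hself := chartMetric_self g.inner p
  set x := extChartAt 𝓘(ℝ, E) p p with hx
  set G := chartMetric 𝓘(ℝ, E) g.inner p with hGdef
  have haa := hG.nonneg hp a
  have hbb := hG.nonneg hp b
  by_cases hab : LinearIndependent ℝ ![a, b]
  · have hb : b ≠ 0 := hab.ne_zero 1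
    have hbpos := hG.pos x hp b hb
    -- the Gram determinant is positive
    have hD : 0 < G x a a * G x b b - G x a b ^ 2 := by
      have hne : G x b b • a - G x a b • b ≠ 0 := fun h0 => by
        have := (LinearIndependent.pair_iff.1 hab) (G x b b) (-G x a b)
          (by rw [neg_smul, ← sub_eq_add_neg, h0])
        exact hbpos.ne' this.1
      have h1 := hG.pos x hp _ hne
      have hsym := hG.symm x hp b a
      simp only [map_sub, map_smul, sub_apply, smul_apply, smul_eq_mul, hsym] at h1
      by_contra! hneg
      nlinarith [mul_nonneg hbpos.le (sub_nonneg.2 hneg)]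
    have h2 : |G x (curv G x a b b) a / (G x a a * G x b b - G x a b ^ 2)| ≤ C := by
      have := hC p a b hab
      unfold sectionalAt curvAt at this
      rw [← hself] at this
      exact this
    rw [abs_div, abs_of_pos hD, div_le_iff₀ hD] at h2
    refine h2.trans (mul_le_mul (le_max_left _ _) ?_ hD.le (le_max_right _ _))
    nlinarith [sq_nonneg (G x a b)]
  · rw [curv_eq_zero_of_not_linearIndependent G x a b hab, map_zero, zero_apply, abs_zero]
    exact mul_nonneg (le_max_right _ _) (mul_nonneg haa hbb)

/-- If the curvature form is bounded by `C`, the tangent sphere bundle has positive scalar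
curvature as soon as the contribution of the second fundamental form exceeds the bound for the
scalar curvature of the tangent bundle. -/
theorem hasPositiveScalarCurvature_sphereBundle {r : ℝ} (hr : 0 < r) {C : ℝ} (hC0 : 0 ≤ C)
    (hC : ∀ (p : M) (a b : E),
      |chartMetric 𝓘(ℝ, E) g.inner p (extChartAt 𝓘(ℝ, E) p p)
        (curv (chartMetric 𝓘(ℝ, E) g.inner p) (extChartAt 𝓘(ℝ, E) p p) a b b) a| ≤
      C * (chartMetric 𝓘(ℝ, E) g.inner p (extChartAt 𝓘(ℝ, E) p p) a a *
        chartMetric 𝓘(ℝ, E) g.inner p (extChartAt 𝓘(ℝ, E) p p) b b))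
    (hE : 1 ≤ Module.finrank ℝ E) {f₁ f₂ : ℝ} (h₁ : 0 < f₁) (h₂ : 0 < f₂)
    (hlt : (Module.finrank ℝ E : ℝ) ^ 2 * C / f₁
        + 3 * (Module.finrank ℝ E : ℝ) ^ 3 * C ^ 2 * r ^ 2 * f₂ / f₁ ^ 2 <
      (Module.finrank ℝ E - 1) * (Module.finrank ℝ E - 2) / (f₂ * r ^ 2)) :
    HasPositiveScalarCurvature 𝓘(ℝ, E).tangent (2 * Module.finrank ℝ E - 1)
      (sasakiMetric g.inner f₁ f₂) (sphereBundle g.inner r) := by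
  refine ⟨isSubmanifold_sphereBundle g hr, fun V ψ hψ z hz => ?_⟩
  rw [(hψ.ric_scal g hr (by omega) h₁ h₂ hz).2]
  have hu : chartMetric 𝓘(ℝ, E) g.inner (ψ z).proj
      (extChartAt 𝓘(ℝ, E) (ψ z).proj (ψ z).proj) (ψ z).snd (ψ z).snd = r ^ 2 := by
    rw [chartMetric_self]
    obtain ⟨O, -, hO⟩ := hψ.image_eq
    exact (hO.subset (mem_image_of_mem ψ hz)).1
  have h3 := scal_coordSasaki_ge (isMetricOn_chartMetric g (ψ z).proj) h₁ h₂
    (mem_extChartAt_target (ψ z).proj) hC0 (hC (ψ z).proj) (ψ z).snd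
  rw [hu] at h3
  have h4 : scalAt 𝓘(ℝ, E).tangent (sasakiMetric g.inner f₁ f₂) (ψ z) =
      scal (coordSasaki (chartMetric 𝓘(ℝ, E) g.inner (ψ z).proj) f₁ f₂)
        (extChartAt 𝓘(ℝ, E) (ψ z).proj (ψ z).proj, (ψ z).snd) := by
    unfold scalAt
    rw [scal_congr (chartMetric_sasakiMetric_eventuallyEq g f₁ f₂ (ψ z))]
    exact congrArg _ (extChartAt_tangent_self (ψ z))
  rw [h4]
  linarith

end Sphere

/-! ### Choice of the weights -/

/-- The bound for the scalar curvature of the tangent bundle tends to `0` as `f₁` grows. -/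
theorem exists_forall_ge_bound {A B κ : ℝ} (hA : 0 ≤ A) (hB : 0 ≤ B) (hκ : 0 < κ) :
    ∃ c : ℝ, 0 < c ∧ ∀ f : ℝ, c ≤ f → A / f + B / f ^ 2 < κ := by
  refine ⟨(A + B) / κ + 1, by positivity, fun f hf => ?_⟩
  have h1 : 1 ≤ f := le_trans (by linarith [div_nonneg (add_nonneg hA hB) hκ.le]) hf
  have h0 : 0 < f := by linarith
  have h2 : B / f ^ 2 ≤ B / f := div_le_div_of_nonneg_left hB h0 (by nlinarith)
  have h3 : (A + B) / f < κ := by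
    rw [div_lt_iff₀ h0]
    have : (A + B) / κ < f := by linarith
    rwa [div_lt_iff₀ hκ, mul_comm] at this
  rw [add_div] at h3
  linarith

/-- As `f₂` tends to `0`, the contribution of the second fundamental form of the sphere bundle
grows, and the bound for the scalar curvature of the tangent bundle does not. -/
theorem exists_forall_le_bound {A B κ : ℝ} (hA : 0 ≤ A) (hB : 0 ≤ B) (hκ : 0 < κ) :
    ∃ c : ℝ, 0 < c ∧ ∀ f : ℝ, 0 < f → f ≤ c → A + B * f < κ / f := by
  refine ⟨min 1 (κ / (A + B + 1)), by positivity, fun f h0 hf => ?_⟩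
  have h1 : f ≤ 1 := hf.trans (min_le_left _ _)
  have h2 : f ≤ κ / (A + B + 1) := hf.trans (min_le_right _ _)
  rw [le_div_iff₀ (by positivity)] at h2
  rw [lt_div_iff₀ h0]
  nlinarith [mul_nonneg hB h0.le]

end RiemCurv
end

theorem theorem1p2
    {E : Type*} [NormedAddCommGroup E] [NormedSpace ℝ E] [FiniteDimensional ℝ E]
    {M : Type*} [TopologicalSpace M] [ChartedSpace E M] [IsManifold 𝓘(ℝ, E) ∞ M]
    (g : Bundle.ContMDiffRiemannianMetric 𝓘(ℝ, E) ∞ E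
      (fun x : M => TangentSpace 𝓘(ℝ, E) x))
    (r : ℝ) (hr : 0 < r) :
    (Module.finrank ℝ E = 2 → ∀ f₁ f₂ : ℝ, 0 < f₁ → 0 < f₂ →
      RiemCurv.SameRicciAndScalarCurvature 𝓘(ℝ, E).tangent (2 * Module.finrank ℝ E - 1)
        (RiemCurv.sasakiMetric g.inner f₁ f₂) (RiemCurv.sphereBundle g.inner r)) ∧
    (3 ≤ Module.finrank ℝ E → RiemCurv.BoundedSectionalCurvature 𝓘(ℝ, E) g.inner →
      (∀ f₂ : ℝ, 0 < f₂ → ∃ c : ℝ, 0 < c ∧ ∀ f₁ : ℝ, c ≤ f₁ →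
        RiemCurv.HasPositiveScalarCurvature 𝓘(ℝ, E).tangent (2 * Module.finrank ℝ E - 1)
          (RiemCurv.sasakiMetric g.inner f₁ f₂) (RiemCurv.sphereBundle g.inner r)) ∧
      (∀ f₁ : ℝ, 0 < f₁ → ∃ c : ℝ, 0 < c ∧ ∀ f₂ : ℝ, 0 < f₂ → f₂ ≤ c →
        RiemCurv.HasPositiveScalarCurvature 𝓘(ℝ, E).tangent (2 * Module.finrank ℝ E - 1)
          (RiemCurv.sasakiMetric g.inner f₁ f₂) (RiemCurv.sphereBundle g.inner r))) := by
  refine ⟨fun hE f₁ f₂ h₁ h₂ =>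
    ⟨RiemCurv.isSubmanifold_sphereBundle g hr, fun V ψ hψ z hz => ?_⟩, fun hE hK => ?_⟩
  · have hE' : (Module.finrank ℝ E : ℝ) = 2 := by exact_mod_cast hE
    obtain ⟨h3, h4⟩ := hψ.ric_scal g hr (by omega) h₁ h₂ hz
    refine ⟨fun v w => (h3 v w).trans ?_, h4.trans ?_⟩ <;> simp [hE']
  · obtain ⟨C, hC0, hC⟩ := hK.exists_bound
    have hE' : (3 : ℝ) ≤ Module.finrank ℝ E := by exact_mod_cast hE
    have hκ : (0 : ℝ) < (Module.finrank ℝ E - 1) * (Module.finrank ℝ E - 2) :=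
      mul_pos (by linarith) (by linarith)
    refine ⟨fun f₂ h₂ => ?_, fun f₁ h₁ => ?_⟩
    · obtain ⟨c, hc, hlt⟩ := RiemCurv.exists_forall_ge_bound
        (A := (Module.finrank ℝ E : ℝ) ^ 2 * C)
        (B := 3 * (Module.finrank ℝ E : ℝ) ^ 3 * C ^ 2 * r ^ 2 * f₂)
        (κ := (Module.finrank ℝ E - 1) * (Module.finrank ℝ E - 2) / (f₂ * r ^ 2))
        (by positivity) (by positivity) (by positivity)
      exact ⟨c, hc, fun f₁ hf => RiemCurv.hasPositiveScalarCurvature_sphereBundle g hr hC0 hC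
        (by omega) (hc.trans_le hf) h₂ (hlt f₁ hf)⟩
    · obtain ⟨c, hc, hlt⟩ := RiemCurv.exists_forall_le_bound
        (A := (Module.finrank ℝ E : ℝ) ^ 2 * C / f₁)
        (B := 3 * (Module.finrank ℝ E : ℝ) ^ 3 * C ^ 2 * r ^ 2 / f₁ ^ 2)
        (κ := (Module.finrank ℝ E - 1) * (Module.finrank ℝ E - 2) / r ^ 2)
        (by positivity) (by positivity) (by positivity)
      refine ⟨c, hc, fun f₂ h₂ hf => RiemCurv.hasPositiveScalarCurvature_sphereBundle g hr hC0 hC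
        (by omega) h₁ h₂ ?_⟩
      have := hlt f₂ h₂ hf
      rwa [div_div, mul_comm (r ^ 2), div_mul_eq_mul_div] at this
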